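/- Let $N\ge 1$ be an integer, let $\alpha,\nu>0$ be real numbers, let $\mu_1,\dots,\mu_N$ be non-zero complex numbers and let $\delta_1,\dots,\delta_N$ be positive real numbers. For $n\in\mathbb N_0$ let $L_n^{(a)}(x)=\frac{(a+1)_n}{n!}\sum_{k=0}^n\frac{(-n)_k}{(a+1)_k\,k!}x^k$ be the scalar Laguerre polynomial. For $x>0$ define the $N\times N$ matrix weight $$W(x)=W_\mu^{(\alpha,\nu)}(x)=L(x)\,T(x)\,L(x)^*,\qquad T(x)_{i,j}=\delta_{i,j}\,e^{-x}x^{\nu+i}\delta_i,\qquad L(x)_{i,j}=\begin{cases}\frac{\mu_i}{\mu_j}L_{i-j}^{(\alpha+j)}(x)& i\ge j,\\ 0& i<j,\end{cases}$$ for $1\le i,j\le N$ (here $\delta_{i,j}$ is the Kronecker delta). Let $L^2(W)$ be the Hilbert space of (classes modulo almost everywhere equality of) measurable row vector valued functions $f\colon(0,\infty)\to\mathbb C^N$ with $\int_0^\infty f(x)W(x)f(x)^*\,dx<\infty$, with inner product $\langle f,g\rangle_W=\int_0^\infty f(x)W(x)g(x)^*\,dx$, and let $\mathrm{Pol}\subset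 L^2(W)$ be the space of row vector valued polynomials, i.e. row vectors of length $N$ with entries in $\mathbb C[x]$. Let $J=\mathrm{diag}(1,\dots,N)$, let $A$ be the $N\times N$ matrix with $A_{i,i-1}=-\mu_i/\mu_{i-1}$ for $2\le i\le N$ and all other entries $0$, and let $T_0$ be the operator with domain $\mathrm{Pol}$ given by $$p\cdot T_0=x\,p''+p'\,(M_1x+M_2)+p\,C,$$ $$M_1=-(A+1)^{-1},\qquad M_2=\nu+J+1+(\alpha+J)A,\qquad C=(\alpha-\nu)(A+1)^{-1}-J.$$ Then $T_0$ is essentially self-adjoint on $L^2(W)$: it is densely defined and symmetric, and its closure $\overline{T_0}$ is self-adjoint. Moreover $\overline{T_0}$ has compact resolvent (its resolvent set is non-empty and $(\overline{T_0}-z)^{-1}$ is a compact operator for every $z$ in the resolvent set), and its spectrum is $$\sigma(\overline{T_0})=\alpha-\nu-1-\mathbb N_0=\{\alpha-\nu-1-n\mid n\in\mathbb N_0\}.$$ -/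

import Mathlib

open MeasureTheory Polynomial
open scoped Matrix

noncomputable section

namespace MatrixLaguerre

/-! ### Unbounded operators: essential self-adjointness, spectrum, compact resolvent -/

section Operators

variable {E : Type*} [NormedAddCommGroup E] [InnerProductSpace ℂ E]

/-- A densely defined symmetric operator whose closure is self-adjoint. -/
def IsEssentiallySelfAdjoint [CompleteSpace E] (T : E →ₗ.[ℂ] E) : Prop :=
  Dense (T.domain : Set E) ∧ T.IsFormalAdjoint T ∧ T.IsClosable ∧ IsSelfAdjoint T.closure

/-- The bounded operator `R` is the resolvent `(T - z)⁻¹`: it maps `E` into the domain of `T`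
and is a two-sided inverse of `T - z : D(T) → E`. -/
def IsResolventAt (T : E →ₗ.[ℂ] E) (z : ℂ) (R : E →L[ℂ] E) : Prop :=
  (∀ y : E, ∃ h : R y ∈ T.domain, T ⟨R y, h⟩ - z • R y = y) ∧
    ∀ x : T.domain, R (T x - z • (x : E)) = x

/-- The resolvent set of an unbounded operator. -/
def resolventSet (T : E →ₗ.[ℂ] E) : Set ℂ := {z | ∃ R : E →L[ℂ] E, IsResolventAt T z R}

/-- The spectrum of an unbounded operator. -/
def spectrum (T : E →ₗ.[ℂ] E) : Set ℂ := (resolventSet T)ᶜ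

/-- The resolvent set is non-empty, and the resolvent is compact at each of its points. -/
def HasCompactResolvent (T : E →ₗ.[ℂ] E) : Prop :=
  (resolventSet T).Nonempty ∧
    ∀ (z : ℂ) (R : E →L[ℂ] E), IsResolventAt T z R → IsCompactOperator R

end Operators

/-! ### The weight -/

/-- The scalar Laguerre polynomial
`L_n^{(a)}(x) = (a+1)_n / n! * ∑_k (-n)_k / ((a+1)_k k!) x^k`. -/
def laguerre (n : ℕ) (a : ℝ) : ℝ[X] :=
  C ((ascPochhammer ℝ n).eval (a + 1) / (n.factorial : ℝ)) *
    ∑ k ∈ Finset.range (n + 1),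
      C ((ascPochhammer ℝ k).eval (-(n : ℝ)) /
        ((ascPochhammer ℝ k).eval (a + 1) * (k.factorial : ℝ))) * X ^ k

/-- The parameters of the matrix Laguerre weight of size `N`. -/
structure Params (N : ℕ) where
  α : ℝ
  ν : ℝ
  μ : Fin N → ℂ
  δ : Fin N → ℝ
  α_pos : 0 < α
  ν_pos : 0 < ν
  μ_ne_zero : ∀ i, μ i ≠ 0
  δ_pos : ∀ i, 0 < δ i

variable {N : ℕ} (P : Params N)

namespace Params

/-- The one-based index of `i : Fin N`. -/
def idx (i : Fin N) : ℝ := (i : ℝ) + 1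

/-- The lower triangular matrix polynomial `L_μ^{(α)}`, with entries
`(μ_i / μ_j) L_{i-j}^{(α+j)}` for `i ≥ j` (one-based indices). -/
def LPoly : Matrix (Fin N) (Fin N) ℂ[X] :=
  Matrix.of fun i j =>
    if j ≤ i then
      C (P.μ i / P.μ j) *
        (laguerre ((i : ℕ) - (j : ℕ)) (P.α + idx j)).map (algebraMap ℝ ℂ)
    else 0

/-- The matrix `L_μ^{(α)}(x)`. -/
def L (x : ℝ) : Matrix (Fin N) (Fin N) ℂ := P.LPoly.map (Polynomial.eval (x : ℂ))

/-- The diagonal entries `e^{-x} x^{ν+i} δ_i` (one-based index) of `T^{(ν)}(x)`. -/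
def t (x : ℝ) (i : Fin N) : ℝ := Real.exp (-x) * x ^ (P.ν + idx i) * P.δ i

/-- The weight `W(x) = L(x) T(x) L(x)^*`. -/
def W (x : ℝ) : Matrix (Fin N) (Fin N) ℂ :=
  P.L x * Matrix.diagonal (fun i => (P.t x i : ℂ)) * (P.L x)ᴴ

/-! ### The differential operator on row polynomials -/

/-- The matrix `J = diag(1, …, N)`. -/
def J (N : ℕ) : Matrix (Fin N) (Fin N) ℂ := Matrix.diagonal fun i => (idx i : ℂ)

/-- The matrix `A_μ`: minus `μ_i / μ_{i-1}` at the entries `(i, i-1)`, zero elsewhere. -/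
def A : Matrix (Fin N) (Fin N) ℂ :=
  Matrix.of fun i j => if (j : ℕ) + 1 = (i : ℕ) then -(P.μ i / P.μ j) else 0

def M₁ : Matrix (Fin N) (Fin N) ℂ := -(P.A + 1)⁻¹

def M₂ : Matrix (Fin N) (Fin N) ℂ :=
  (P.ν : ℂ) • (1 : Matrix (Fin N) (Fin N) ℂ) + J N + 1
    + ((P.α : ℂ) • (1 : Matrix (Fin N) (Fin N) ℂ) + J N) * P.A

def C₀ : Matrix (Fin N) (Fin N) ℂ := ((P.α : ℂ) - (P.ν : ℂ)) • (P.A + 1)⁻¹ - J N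

/-- Entrywise derivative of a row polynomial. -/
def deriv (N : ℕ) : (Fin N → ℂ[X]) →ₗ[ℂ] (Fin N → ℂ[X]) where
  toFun p := fun i => derivative (p i)
  map_add' p q := by ext1 i; simp
  map_smul' c p := by ext1 i; simp

/-- The action from the right `p ↦ p'' x + p' (M₁ x + M₂) + p C` of `T₀` on row polynomials. -/
def T₀Poly : (Fin N → ℂ[X]) →ₗ[ℂ] (Fin N → ℂ[X]) where
  toFun p :=
    (X : ℂ[X]) • deriv N (deriv N p)
      + deriv N p ᵥ* ((X : ℂ[X]) • P.M₁.map C + P.M₂.map C)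
      + p ᵥ* P.C₀.map C
  map_add' p q := by
    simp only [map_add, smul_add, Matrix.add_vecMul]; abel
  map_smul' c p := by
    simp only [map_smul, Matrix.smul_vecMul, smul_add, RingHom.id_apply, smul_comm (X : ℂ[X]) c]

theorem T₀Poly_apply (p : Fin N → ℂ[X]) :
    P.T₀Poly p = (X : ℂ[X]) • deriv N (deriv N p)
      + deriv N p ᵥ* ((X : ℂ[X]) • P.M₁.map C + P.M₂.map C)
      + p ᵥ* P.C₀.map C := rfl

theorem deriv_apply (p : Fin N → ℂ[X]) (i : Fin N) : deriv N p i = derivative (p i) := rfl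

/-! ### The Hilbert space `L²(W)` -/

/-- Lebesgue measure on `(0, ∞)`. -/
abbrev vol : Measure ℝ := volume.restrict (Set.Ioi 0)

/-- The pointwise sesquilinear form `f(x) W(x) g(x)^*` of two row vector valued functions. -/
def form (f g : ℝ → Fin N → ℂ) (x : ℝ) : ℂ := (f x ᵥ* P.W x) ⬝ᵥ star (g x)

/-- The factor `S(x) = L(x) T(x)^{1/2}` of the weight `W(x) = S(x) S(x)^*`. -/
def S (x : ℝ) : Matrix (Fin N) (Fin N) ℂ :=
  P.L x * Matrix.diagonal (fun i => (Real.sqrt (P.t x i) : ℂ))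

/-- The function `f(x) S(x)`, with values in the Euclidean space. -/
def mulS (f : ℝ → Fin N → ℂ) (x : ℝ) : EuclideanSpace ℂ (Fin N) := WithLp.toLp 2 (f x ᵥ* P.S x)

theorem t_pos {x : ℝ} (hx : 0 < x) (i : Fin N) : 0 < P.t x i :=
  mul_pos (mul_pos (Real.exp_pos _) (Real.rpow_pos_of_pos hx _)) (P.δ_pos i)

theorem W_eq {x : ℝ} (hx : 0 < x) : P.W x = P.S x * (P.S x)ᴴ := by
  have h : Matrix.diagonal (fun i => (P.t x i : ℂ)) =
      Matrix.diagonal (fun i => (Real.sqrt (P.t x i) : ℂ)) *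
        (Matrix.diagonal (fun i => (Real.sqrt (P.t x i) : ℂ)))ᴴ := by
    rw [Matrix.diagonal_conjTranspose, Matrix.diagonal_mul_diagonal]
    congr 1
    funext i
    simp only [Pi.star_apply, RCLike.star_def, Complex.conj_ofReal]
    rw [← Complex.ofReal_mul, Real.mul_self_sqrt (P.t_pos hx i).le]
  rw [W, S, h, Matrix.conjTranspose_mul]
  simp only [Matrix.mul_assoc]

theorem form_eq (f g : ℝ → Fin N → ℂ) {x : ℝ} (hx : 0 < x) :
    P.form f g x = inner ℂ (P.mulS g x) (P.mulS f x) := by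
  rw [form, W_eq P hx, mulS, mulS, EuclideanSpace.inner_toLp_toLp, ← Matrix.vecMul_vecMul,
    ← Matrix.dotProduct_mulVec, Matrix.star_vecMul]

theorem form_ae (f g : ℝ → Fin N → ℂ) :
    P.form f g =ᵐ[vol] fun x => inner ℂ (P.mulS g x) (P.mulS f x) := by
  filter_upwards [ae_restrict_mem measurableSet_Ioi] with x hx using P.form_eq f g hx

theorem laguerre_zero (a : ℝ) : laguerre 0 a = 1 := by
  simp [laguerre]

theorem det_L (x : ℝ) : (P.L x).det = 1 := by
  rw [Matrix.det_of_isLowerTriangular]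
  · refine Finset.prod_eq_one fun i _ => ?_
    simp [L, LPoly, laguerre_zero, div_self (P.μ_ne_zero i)]
  · intro i j hij
    have h : i < j := hij
    simp [L, LPoly, not_le.mpr h]

theorem isUnit_S {x : ℝ} (hx : 0 < x) : IsUnit (P.S x).det := by
  rw [S, Matrix.det_mul, det_L, one_mul, Matrix.det_diagonal, isUnit_iff_ne_zero]
  refine Finset.prod_ne_zero_iff.mpr fun i _ => ?_
  exact_mod_cast (Real.sqrt_pos.mpr (P.t_pos hx i)).ne'

theorem measurable_S (i j : Fin N) : Measurable fun x => P.S x i j := by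
  have h1 : Measurable fun x => P.L x i j := by
    simp only [L, Matrix.map_apply]
    exact ((P.LPoly i j).continuous.comp Complex.continuous_ofReal).measurable
  have h2 : Measurable fun x => (Real.sqrt (P.t x j) : ℂ) := by
    unfold t
    fun_prop
  simp only [S, Matrix.mul_diagonal]
  exact h1.mul h2

theorem measurable_det {B : ℝ → Matrix (Fin N) (Fin N) ℂ}
    (hB : ∀ i j, Measurable fun x => B x i j) : Measurable fun x => (B x).det := by
  simp only [Matrix.det_apply]
  refine Finset.measurable_fun_sum _ fun σ _ => ?_
  exact (Finset.measurable_fun_prod _ fun i _ => hB _ _).const_smul _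

theorem measurable_S_inv (i j : Fin N) : Measurable fun x => (P.S x)⁻¹ i j := by
  have ha : Measurable fun x => (P.S x).adjugate i j := by
    simp only [Matrix.adjugate_apply]
    refine measurable_det fun k l => ?_
    by_cases hk : k = j
    · simp [hk]
    · simpa [Matrix.updateRow_ne hk] using P.measurable_S k l
  simp only [Matrix.inv_def, Matrix.smul_apply, Ring.inverse_eq_inv', smul_eq_mul]
  exact (measurable_det P.measurable_S).inv.mul ha

theorem aesm_vecMul {f : ℝ → Fin N → ℂ} (hf : AEStronglyMeasurable f vol)
    {B : ℝ → Matrix (Fin N) (Fin N) ℂ} (hB : ∀ i j, Measurable fun x => B x i j) :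
    AEStronglyMeasurable (fun x => f x ᵥ* B x) vol := by
  refine AEMeasurable.aestronglyMeasurable (aemeasurable_pi_iff.mpr fun j => ?_)
  simp only [Matrix.vecMul, dotProduct]
  refine Finset.aemeasurable_fun_sum _ fun i _ => ?_
  exact (aemeasurable_pi_iff.mp hf.aemeasurable i).mul (hB i j).aemeasurable

theorem aesm_mulS {f : ℝ → Fin N → ℂ} (hf : AEStronglyMeasurable f vol) :
    AEStronglyMeasurable (P.mulS f) vol :=
  (PiLp.continuous_toLp 2 _).comp_aestronglyMeasurable (aesm_vecMul hf P.measurable_S)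

theorem integrable_form_iff {f : ℝ → Fin N → ℂ} (hf : AEStronglyMeasurable f vol) :
    Integrable (P.form f f) vol ↔ MemLp (P.mulS f) 2 vol := by
  rw [memLp_two_iff_integrable_sq_norm (P.aesm_mulS hf), integrable_congr (P.form_ae f f)]
  simp only [inner_self_eq_norm_sq_to_K]
  refine ⟨fun h => ?_, fun h => ?_⟩
  · simpa [← Complex.ofReal_pow] using h.re
  · simpa using h.ofReal (𝕜 := ℂ)

theorem mulS_congr {f g : ℝ → Fin N → ℂ} (h : f =ᵐ[vol] g) : P.mulS f =ᵐ[vol] P.mulS g := by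
  filter_upwards [h] with x hx
  simp [mulS, hx]

theorem mulS_add (f g : ℝ → Fin N → ℂ) : P.mulS (f + g) = P.mulS f + P.mulS g := by
  funext x
  simp [mulS, Matrix.add_vecMul]

theorem mulS_smul (c : ℂ) (f : ℝ → Fin N → ℂ) : P.mulS (c • f) = c • P.mulS f := by
  funext x
  simp [mulS, Matrix.smul_vecMul]

/-- `L²(W)`: classes modulo equality almost everywhere of measurable row vector valued functions
`f` on `(0, ∞)` for which `f W f^*` is integrable. -/
def L2Sub : Submodule ℂ (ℝ →ₘ[vol] (Fin N → ℂ)) where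
  carrier := {f | Integrable (P.form f f) vol}
  zero_mem' := by
    change Integrable _ _
    rw [P.integrable_form_iff (AEEqFun.aestronglyMeasurable _)]
    have h : P.mulS (0 : ℝ →ₘ[vol] (Fin N → ℂ)) =ᵐ[vol] 0 := by
      filter_upwards [AEEqFun.coeFn_zero (μ := vol) (β := Fin N → ℂ)] with x hx
      simp [mulS, hx]
    exact (memLp_congr_ae h).mpr MemLp.zero
  add_mem' {f g} hf hg := by
    change Integrable _ _ at hf hg ⊢
    rw [P.integrable_form_iff (AEEqFun.aestronglyMeasurable _)] at hf hg ⊢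
    rw [memLp_congr_ae (P.mulS_congr (AEEqFun.coeFn_add f g)), mulS_add]
    exact hf.add hg
  smul_mem' c f hf := by
    change Integrable _ _ at hf ⊢
    rw [P.integrable_form_iff (AEEqFun.aestronglyMeasurable _)] at hf ⊢
    rw [memLp_congr_ae (P.mulS_congr (AEEqFun.coeFn_smul c f)), mulS_smul]
    exact hf.const_smul c

/-- The space `L²(W)` as a type. -/
def L2 : Type := P.L2Sub

instance : AddCommGroup P.L2 := inferInstanceAs (AddCommGroup P.L2Sub)

instance : Module ℂ P.L2 := inferInstanceAs (Module ℂ P.L2Sub)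

/-- A representative of an element of `L²(W)`. -/
def L2.fn {P : Params N} (f : P.L2) : ℝ → Fin N → ℂ := (f.1 : ℝ →ₘ[vol] (Fin N → ℂ))

theorem L2.aesm {P : Params N} (f : P.L2) : AEStronglyMeasurable f.fn vol :=
  AEEqFun.aestronglyMeasurable _

theorem L2.memLp {P : Params N} (f : P.L2) : MemLp (P.mulS f.fn) 2 vol :=
  (P.integrable_form_iff f.aesm).mp f.2

/-- The linear map `f ↦ f S` from `L²(W)` to the unweighted `L²` space. -/
def toLp : P.L2 →ₗ[ℂ] Lp (EuclideanSpace ℂ (Fin N)) 2 vol where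
  toFun f := f.memLp.toLp
  map_add' f g := by
    rw [← MemLp.toLp_add, MemLp.toLp_eq_toLp_iff, ← mulS_add]
    exact P.mulS_congr (AEEqFun.coeFn_add f.1 g.1)
  map_smul' c f := by
    rw [RingHom.id_apply, ← MemLp.toLp_const_smul, MemLp.toLp_eq_toLp_iff, ← mulS_smul]
    exact P.mulS_congr (AEEqFun.coeFn_smul c f.1)

theorem mulS_injective {f g : ℝ → Fin N → ℂ} (h : P.mulS f =ᵐ[vol] P.mulS g) : f =ᵐ[vol] g := by
  filter_upwards [h, ae_restrict_mem measurableSet_Ioi] with x hx hx0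
  have h1 : f x ᵥ* P.S x = g x ᵥ* P.S x := by simpa [mulS] using hx
  have h2 := congrArg (fun v => v ᵥ* (P.S x)⁻¹) h1
  simpa [Matrix.vecMul_vecMul, Matrix.mul_nonsing_inv _ (P.isUnit_S hx0)] using h2

theorem toLp_injective : Function.Injective P.toLp := by
  intro f g h
  refine Subtype.ext (AEEqFun.ext (P.mulS_injective ?_))
  exact (MemLp.toLp_eq_toLp_iff f.memLp g.memLp).mp h

/-- The class in `L²(W)` of a square integrable function. -/
def mkL2 (f : ℝ → Fin N → ℂ) (hf : AEStronglyMeasurable f vol)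
    (h : Integrable (P.form f f) vol) : P.L2 :=
  ⟨AEEqFun.mk f hf, by
    change Integrable _ _
    rw [P.integrable_form_iff (AEEqFun.aestronglyMeasurable _),
      memLp_congr_ae (P.mulS_congr (AEEqFun.coeFn_mk f hf))]
    exact (P.integrable_form_iff hf).mp h⟩

theorem mkL2_fn (f : ℝ → Fin N → ℂ) (hf : AEStronglyMeasurable f vol)
    (h : Integrable (P.form f f) vol) : (P.mkL2 f hf h).fn =ᵐ[vol] f :=
  AEEqFun.coeFn_mk f hf

theorem toLp_surjective : Function.Surjective P.toLp := by
  intro u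
  let f : ℝ → Fin N → ℂ := fun x => WithLp.ofLp (u x) ᵥ* (P.S x)⁻¹
  have hf : AEStronglyMeasurable f vol :=
    aesm_vecMul ((PiLp.continuous_ofLp 2 _).comp_aestronglyMeasurable
      (Lp.aestronglyMeasurable u)) P.measurable_S_inv
  have hu : P.mulS f =ᵐ[vol] u := by
    filter_upwards [ae_restrict_mem measurableSet_Ioi] with x hx
    simp [mulS, f, Matrix.vecMul_vecMul, Matrix.nonsing_inv_mul _ (P.isUnit_S hx)]
  have h : Integrable (P.form f f) vol :=
    (P.integrable_form_iff hf).mpr ((memLp_congr_ae hu).mpr (Lp.memLp u))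
  refine ⟨P.mkL2 f hf h, ?_⟩
  refine Lp.ext ((MemLp.coeFn_toLp (P.mkL2 f hf h).memLp).trans ?_)
  exact (P.mulS_congr (P.mkL2_fn f hf h)).trans hu

/-- The inner product `∫ g W f^* dx`, linear in the second argument `g`. -/
instance : Inner ℂ P.L2 := ⟨fun f g => ∫ x, P.form g.fn f.fn x ∂vol⟩

theorem inner_def (f g : P.L2) : inner ℂ f g = ∫ x, P.form g.fn f.fn x ∂vol := rfl

theorem inner_eq (f g : P.L2) : inner ℂ f g = inner ℂ (P.toLp f) (P.toLp g) := by
  rw [inner_def, L2.inner_def]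
  refine integral_congr_ae ?_
  filter_upwards [P.form_ae g.fn f.fn, MemLp.coeFn_toLp f.memLp, MemLp.coeFn_toLp g.memLp]
    with x h1 h2 h3
  rw [h1]
  change _ = inner ℂ (f.memLp.toLp (P.mulS f.fn) x) (g.memLp.toLp (P.mulS g.fn) x)
  rw [h2, h3]

/-- The axioms of an inner product. -/
@[reducible]
def core : InnerProductSpace.Core ℂ P.L2 where
  inner := inner ℂ
  conj_inner_symm f g := by rw [P.inner_eq, P.inner_eq, inner_conj_symm]
  re_inner_nonneg f := by rw [P.inner_eq]; exact inner_self_nonneg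
  add_left f g h := by simp only [P.inner_eq, map_add, inner_add_left]
  smul_left f g c := by simp only [P.inner_eq, map_smul, inner_smul_left]
  definite f h := by
    rw [P.inner_eq, inner_self_eq_zero] at h
    exact P.toLp_injective (h.trans (map_zero _).symm)

/-- The norm of `L²(W)` is `‖f‖ = (∫ f W f^* dx)^{1/2}`. -/
instance : NormedAddCommGroup P.L2 := P.core.toNormedAddCommGroup

instance : InnerProductSpace ℂ P.L2 := InnerProductSpace.ofCore P.core.toCore

/-- `f ↦ f S` is unitary. -/
def toLpIsometry : P.L2 ≃ₗᵢ[ℂ] Lp (EuclideanSpace ℂ (Fin N)) 2 vol :=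
  (LinearEquiv.ofBijective P.toLp ⟨P.toLp_injective, P.toLp_surjective⟩).isometryOfInner
    fun f g => (P.inner_eq f g).symm

instance : CompleteSpace P.L2 :=
  P.toLpIsometry.toIsometryEquiv.completeSpace

/-! ### `T₀` as an unbounded operator on `L²(W)` with domain the row polynomials -/

/-- The function on the line given by a row polynomial. -/
def polyFun (p : Fin N → ℂ[X]) (x : ℝ) : Fin N → ℂ := fun i => (p i).eval (x : ℂ)

theorem polyFun_aesm (p : Fin N → ℂ[X]) : AEStronglyMeasurable (polyFun p) vol := by
  refine Continuous.aestronglyMeasurable (continuous_pi fun i => ?_)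
  exact (p i).continuous.comp Complex.continuous_ofReal

theorem memLp_pow_mul (k : ℕ) (j : Fin N) :
    MemLp (fun x : ℝ => (x : ℂ) ^ k * (Real.sqrt (P.t x j) : ℂ)) 2 vol := by
  have hm : Measurable fun x : ℝ => (x : ℂ) ^ k * (Real.sqrt (P.t x j) : ℂ) := by
    unfold t
    fun_prop
  rw [memLp_two_iff_integrable_sq_norm hm.aestronglyMeasurable]
  have hs : 0 < 2 * (k : ℝ) + P.ν + idx j + 1 := by
    have := P.ν_pos
    unfold idx
    positivity
  have hg := (Real.GammaIntegral_convergent hs).integrable.mul_const (P.δ j)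
  refine hg.congr ?_
  filter_upwards [ae_restrict_mem measurableSet_Ioi] with x hx
  have hx0 : (0 : ℝ) < x := hx
  rw [norm_mul, norm_pow, Complex.norm_real, Complex.norm_real, mul_pow, Real.norm_eq_abs,
    Real.norm_eq_abs, sq_abs, Real.sq_sqrt (P.t_pos hx0 j).le, abs_of_pos hx0, t,
    show 2 * (k : ℝ) + P.ν + idx j + 1 - 1 = ((k * 2 : ℕ) : ℝ) + (P.ν + idx j) by push_cast; ring,
    Real.rpow_add hx0, Real.rpow_natCast, ← pow_mul]
  ring

theorem memLp_poly_mul (q : ℂ[X]) (j : Fin N) :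
    MemLp (fun x : ℝ => q.eval (x : ℂ) * (Real.sqrt (P.t x j) : ℂ)) 2 vol := by
  simp only [Polynomial.eval_eq_sum_range, Finset.sum_mul, mul_assoc]
  exact memLp_finsetSum _ fun k _ => (P.memLp_pow_mul k j).const_mul _

theorem polyFun_vecMul_S (p : Fin N → ℂ[X]) (x : ℝ) (j : Fin N) :
    (polyFun p x ᵥ* P.S x) j =
      ((p ᵥ* P.LPoly) j).eval (x : ℂ) * (Real.sqrt (P.t x j) : ℂ) := by
  simp [S, Matrix.vecMul, dotProduct, L, polyFun, Polynomial.eval_finsetSum, Finset.sum_mul,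
    mul_assoc]

theorem polyFun_integrable (p : Fin N → ℂ[X]) :
    Integrable (P.form (polyFun p) (polyFun p)) vol := by
  rw [P.integrable_form_iff (polyFun_aesm p)]
  refine MemLp.of_eval_piLp fun j => ?_
  simpa only [mulS, polyFun_vecMul_S] using P.memLp_poly_mul ((p ᵥ* P.LPoly) j) j

/-- The embedding of the row polynomials in `L²(W)`. -/
def polyEmb : (Fin N → ℂ[X]) →ₗ[ℂ] P.L2 where
  toFun p := P.mkL2 (polyFun p) (polyFun_aesm p) (P.polyFun_integrable p)
  map_add' p q := by
    refine Subtype.ext (AEEqFun.mk_eq_mk.mpr (Filter.Eventually.of_forall fun x => ?_))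
    ext i
    simp [polyFun]
  map_smul' c p := by
    refine Subtype.ext (AEEqFun.mk_eq_mk.mpr (Filter.Eventually.of_forall fun x => ?_))
    ext i
    simp [polyFun]

theorem polyEmb_injective : Function.Injective P.polyEmb := by
  intro p q h
  have h1 : polyFun p =ᵐ[vol] polyFun q := AEEqFun.mk_eq_mk.mp (congrArg Subtype.val h)
  funext i
  refine Polynomial.eq_of_infinite_eval_eq _ _ ?_
  intro hfin
  have h2 : ({x : ℝ | (p i).eval (x : ℂ) = (q i).eval (x : ℂ)}).Finite :=
    Set.Finite.preimage Complex.ofReal_injective.injOn hfin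
  have h3 : ∀ᵐ x ∂vol, x ∉ {x : ℝ | (p i).eval (x : ℂ) = (q i).eval (x : ℂ)} :=
    measure_eq_zero_iff_ae_notMem.mp (h2.measure_zero vol)
  have h4 : ∀ᵐ x ∂vol, False := by
    filter_upwards [h1, h3] with x hx hx'
    exact hx' (congrFun hx i)
  have h5 : (vol : Measure ℝ) = 0 := ae_eq_bot.mp (Filter.eventually_false_iff_eq_bot.mp h4)
  have h6 : (vol : Measure ℝ) Set.univ = ⊤ := by simp
  simp [h5] at h6

/-- `T₀` as an unbounded operator on `L²(W)`: its domain is the space of row polynomials. -/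
def T₀ : P.L2 →ₗ.[ℂ] P.L2 where
  domain := LinearMap.range P.polyEmb
  toFun := P.polyEmb ∘ₗ P.T₀Poly ∘ₗ (LinearEquiv.ofInjective P.polyEmb P.polyEmb_injective).symm

theorem T₀_apply (p : Fin N → ℂ[X]) :
    P.T₀ ⟨P.polyEmb p, LinearMap.mem_range_self _ p⟩ = P.polyEmb (P.T₀Poly p) := by
  have h : (LinearEquiv.ofInjective P.polyEmb P.polyEmb_injective).symm
      ⟨P.polyEmb p, LinearMap.mem_range_self _ p⟩ = p :=
    (LinearEquiv.symm_apply_eq _).mpr rfl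
  exact congrArg (fun r => P.polyEmb (P.T₀Poly r)) h

end Params

end MatrixLaguerre

end

/-! Multiplication by `L(x)` from the right decouples the problem. It turns the inner product of
`L²(W)` into a sum of scalar ones with weights `e^{-x} x^{ν+j} δ_j`, and it carries `T₀` to the
direct sum of the Laguerre operators `x q'' + (ν+j+1-x) q' + (α-ν-j) q` (`T₀Poly_vecMul_LPoly`).
Since `det L = 1`, it maps row polynomials bijectively to row polynomials. Hence the rows `p` with
`p L = L_n^{(ν+j)} e_j` are polynomial eigenvectors, with eigenvalues `α-ν-j-n`.

The intertwining is an identity of matrix polynomials, verified entrywise from `L_{n+1}' = L_n' -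
L_n` and `x L_{n+1}' = (n+1) L_{n+1} - (n+1+a) L_n`. Symmetry is integration by parts against the
scalar weights. For completeness, a vector orthogonal to all polynomials yields exponentially
decaying functions with vanishing moments, and such functions are zero
(`ae_eq_zero_of_moments_eq_zero`).

The rest is abstract. When the domain of a symmetric operator contains a Hilbert basis of
eigenvectors, the closure is the maximal diagonal operator in that basis, which is self-adjoint; its
resolvent is diagonal with entries `(ev_i - z)⁻¹`. Only `N` values of `j` occur, so `|ev_i|` tends
to infinity, the resolvent is compact and the spectrum is the set of eigenvalues. -/

noncomputable section

namespace MatrixLaguerre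

open Filter Topology

/-! ### Bounded and compact operators that are diagonal in a Hilbert basis -/

section Diagonal

variable {E ι : Type*} [NormedAddCommGroup E] [InnerProductSpace ℂ E]

theorem memℓp_diagonal_mul (b : HilbertBasis ι ℂ E) {c : ι → ℂ} {K : ℝ} (hc : ∀ i, ‖c i‖ ≤ K)
    (y : E) : Memℓp (fun i => c i * b.repr y i) 2 :=
  ((lp.memℓp (b.repr y)).const_smul (K : ℂ)).mono' fun i => by
    have hK : 0 ≤ K := (norm_nonneg _).trans (hc i)
    simpa [abs_of_nonneg hK] using mul_le_mul_of_nonneg_right (hc i) (norm_nonneg (b.repr y i))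

/-- The linear map which is diagonal in a Hilbert basis, with bounded diagonal `c`. -/
def diagonalLin (b : HilbertBasis ι ℂ E) (c : ι → ℂ) (K : ℝ) (hc : ∀ i, ‖c i‖ ≤ K) :
    E →ₗ[ℂ] E where
  toFun y := b.repr.symm ⟨fun i => c i * b.repr y i, memℓp_diagonal_mul b hc y⟩
  map_add' y z := by
    rw [← map_add]
    congr 1
    refine lp.ext (funext fun i => ?_)
    rw [lp.coeFn_add]
    simp [mul_add]
  map_smul' r y := by
    rw [RingHom.id_apply, ← map_smul]
    congr 1
    refine lp.ext (funext fun i => ?_)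
    rw [lp.coeFn_smul]
    simp [mul_left_comm]

/-- The constant is `max K 0` because `hc` does not force `0 ≤ K` when the index type is empty. -/
theorem norm_diagonalLin_le (b : HilbertBasis ι ℂ E) (c : ι → ℂ) (K : ℝ) (hc : ∀ i, ‖c i‖ ≤ K)
    (y : E) : ‖diagonalLin b c K hc y‖ ≤ max K 0 * ‖y‖ := by
  rw [← b.repr.norm_map y]
  change ‖b.repr.symm _‖ ≤ _
  rw [LinearIsometryEquiv.norm_map]
  have h := lp.norm_mono (p := 2) (by simp)
    (x := ⟨fun i => c i * b.repr y i, memℓp_diagonal_mul b hc y⟩)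
    (y := ((max K 0 : ℝ) : ℂ) • b.repr y) fun i => by
      rw [lp.coeFn_smul, Pi.smul_apply, norm_smul, Complex.norm_real, Real.norm_eq_abs,
        abs_of_nonneg (le_max_right K 0), norm_mul]
      exact mul_le_mul_of_nonneg_right ((hc i).trans (le_max_left _ _)) (norm_nonneg _)
  rwa [norm_smul, Complex.norm_real, Real.norm_eq_abs, abs_of_nonneg (le_max_right K 0)] at h

/-- The bounded operator which is diagonal in a Hilbert basis, with bounded diagonal `c`. -/
def diagonalOp (b : HilbertBasis ι ℂ E) (c : ι → ℂ) (K : ℝ) (hc : ∀ i, ‖c i‖ ≤ K) : E →L[ℂ] E :=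
  (diagonalLin b c K hc).mkContinuous (max K 0) (norm_diagonalLin_le b c K hc)

theorem inner_diagonalOp (b : HilbertBasis ι ℂ E) (c : ι → ℂ) (K : ℝ) (hc : ∀ i, ‖c i‖ ≤ K)
    (y : E) (i : ι) : inner ℂ (b i) (diagonalOp b c K hc y) = c i * inner ℂ (b i) y := by
  rw [← b.repr_apply_apply, ← b.repr_apply_apply]
  change b.repr (b.repr.symm _) i = _
  rw [LinearIsometryEquiv.apply_symm_apply]

theorem norm_diagonalOp_le (b : HilbertBasis ι ℂ E) (c : ι → ℂ) (K : ℝ) (hc : ∀ i, ‖c i‖ ≤ K)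
    (hK : 0 ≤ K) : ‖diagonalOp b c K hc‖ ≤ K :=
  (LinearMap.mkContinuous_norm_le _ (le_max_right _ _) _).trans (max_le le_rfl hK)

theorem ext_inner_basis (b : HilbertBasis ι ℂ E) {x y : E}
    (h : ∀ i, inner ℂ (b i) x = inner ℂ (b i) y) : x = y := by
  refine b.repr.injective (lp.ext (funext fun i => ?_))
  rw [b.repr_apply_apply, b.repr_apply_apply, h]

theorem isCompactOperator_finsetSum {F : Type*} [NormedAddCommGroup F] [NormedSpace ℂ F]
    (s : Finset ι) (R : ι → F →L[ℂ] F) (h : ∀ i ∈ s, IsCompactOperator (R i)) :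
    IsCompactOperator (∑ i ∈ s, R i : F →L[ℂ] F) := by
  classical
  induction s using Finset.induction_on with
  | empty => simpa using isCompactOperator_zero
  | insert i s hi ih =>
    rw [Finset.sum_insert hi]
    exact (h i (by simp)).add (ih fun j hj => h j (by simp [hj]))

theorem isCompactOperator_rankOne (u v : E) :
    IsCompactOperator ((innerSL ℂ u).smulRight v : E →L[ℂ] E) := by
  have h1 : IsCompactOperator (innerSL ℂ u : E →L[ℂ] ℂ) :=
    isCompactOperator_of_locallyCompactSpace_dom (innerSL ℂ u)
  exact h1.clm_comp (ContinuousLinearMap.toSpanSingleton ℂ v)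

/-- An operator with diagonal `c` tending to zero is compact. -/
theorem isCompactOperator_of_diagonal [CompleteSpace E] (b : HilbertBasis ι ℂ E) (c : ι → ℂ)
    (hc : Tendsto c cofinite (𝓝 0)) (R : E →L[ℂ] E)
    (hR : ∀ y i, inner ℂ (b i) (R y) = c i * inner ℂ (b i) y) : IsCompactOperator R := by
  classical
  refine isCompactOperator_of_tendsto (l := (atTop : Filter (Finset ι)))
    (F := fun s => ∑ i ∈ s, c i • (innerSL ℂ (b i)).smulRight (b i)) ?_
    (Eventually.of_forall fun s => isCompactOperator_finsetSum _ _ fun i _ =>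
      (isCompactOperator_rankOne (b i) (b i)).smul (c i))
  rw [Metric.tendsto_atTop]
  intro ε hε
  have hfin : {i | ¬ ‖c i‖ < ε / 2}.Finite := by
    have := (tendsto_zero_iff_norm_tendsto_zero.mp hc).eventually (gt_mem_nhds (half_pos hε))
    exact this
  refine ⟨hfin.toFinset, fun s hs => ?_⟩
  -- Removing the finitely many entries of size at least `ε / 2` leaves a diagonal operator of norm
  -- at most `ε / 2`, so `R` is a norm limit of finite rank operators.
  let d : ι → ℂ := fun i => if i ∈ s then 0 else c i
  have hd : ∀ i, ‖d i‖ ≤ ε / 2 := fun i => by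
    by_cases hi : i ∈ s
    · simpa [d, hi] using (half_pos hε).le
    · simp only [d, hi, if_false]
      by_contra h
      exact hi (hs (by simpa using (not_le.mp h).le))
  have key : R - ∑ i ∈ s, c i • (innerSL ℂ (b i)).smulRight (b i) = diagonalOp b d (ε / 2) hd := by
    ext y
    refine ext_inner_basis b fun i => ?_
    rw [inner_diagonalOp, sub_apply, inner_sub_right, hR,
      sum_apply, inner_sum]
    simp only [smul_apply, ContinuousLinearMap.smulRight_apply,
      innerSL_apply_apply, inner_smul_right, orthonormal_iff_ite.mp b.orthonormal, mul_ite, mul_one,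
      mul_zero, Finset.sum_ite_eq, d]
    split_ifs <;> simp
  rw [dist_comm, dist_eq_norm, key]
  exact (norm_diagonalOp_le b d _ hd (half_pos hε).le).trans_lt (half_lt_self hε)

end Diagonal

/-! ### Symmetric operators with a Hilbert basis of eigenvectors -/

section Eigenbasis

variable {E ι : Type*} [NormedAddCommGroup E] [InnerProductSpace ℂ E]
  {T : E →ₗ.[ℂ] E} {b : HilbertBasis ι ℂ E} {ev : ι → ℝ}

/-- The pairs `(x, y)` whose coordinates satisfy `y_i = ev_i x_i`. -/
def diagonalGraph (b : HilbertBasis ι ℂ E) (ev : ι → ℝ) : Submodule ℂ (E × E) where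
  carrier := {p | ∀ i, inner ℂ (b i) p.2 = (ev i : ℂ) * inner ℂ (b i) p.1}
  zero_mem' := by simp
  add_mem' {p q} hp hq i := by
    simp only [Prod.snd_add, Prod.fst_add, inner_add_right, hp i, hq i, mul_add]
  smul_mem' c p hp i := by
    simp only [Prod.smul_snd, Prod.smul_fst, inner_smul_right, hp i, mul_left_comm]

theorem mem_diagonalGraph {p : E × E} : p ∈ diagonalGraph b ev ↔
    ∀ i, inner ℂ (b i) p.2 = (ev i : ℂ) * inner ℂ (b i) p.1 := Iff.rfl

theorem basis_mem_diagonalGraph (b : HilbertBasis ι ℂ E) (ev : ι → ℝ) (i : ι) :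
    (b i, (ev i : ℂ) • b i) ∈ diagonalGraph b ev := by
  classical
  intro j
  by_cases h : j = i
  · simp [h]
  · simp [orthonormal_iff_ite.mp b.orthonormal, h]

/-- Symmetry against `b i` puts every pair of the graph in `diagonalGraph`, which is closed.
Conversely, a pair in `diagonalGraph` is the sum of the multiples of `(b i, ev i • b i)` given by
its coordinates, and these lie in the graph. -/
theorem topologicalClosure_graph_eq (hsymm : T.IsFormalAdjoint T)
    (hb : ∀ i, (b i, (ev i : ℂ) • b i) ∈ T.graph) :
    T.graph.topologicalClosure = diagonalGraph b ev := by
  refine le_antisymm (Submodule.topologicalClosure_minimal _ ?_ ?_) ?_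
  · rintro ⟨x, y⟩ hxy i
    obtain ⟨u, hu, hu'⟩ := T.mem_graph_iff.mp hxy
    obtain ⟨v, hv, hv'⟩ := T.mem_graph_iff.mp (hb i)
    simp only at hu hu' hv hv'
    have h := hsymm v u
    rw [hv', hu', hu, hv, inner_smul_left, Complex.conj_ofReal] at h
    exact h.symm
  · have : ((diagonalGraph b ev : Submodule ℂ (E × E)) : Set (E × E)) =
        ⋂ i, {p | inner ℂ (b i) p.2 = (ev i : ℂ) * inner ℂ (b i) p.1} := by
      ext p
      simp [mem_diagonalGraph]
    rw [this]
    exact isClosed_iInter fun i => isClosed_eq (by fun_prop) (by fun_prop)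
  · rintro ⟨x, y⟩ hxy
    have h1 : HasSum (fun i => (b.repr x i • b i, b.repr y i • b i)) (x, y) :=
      (b.hasSum_repr x).prodMk (b.hasSum_repr y)
    refine mem_closure_of_tendsto h1 (Eventually.of_forall fun s => ?_)
    refine Submodule.sum_mem _ fun i _ => ?_
    have h2 := T.graph.smul_mem (b.repr x i) (hb i)
    rw [b.repr_apply_apply, b.repr_apply_apply, mem_diagonalGraph.mp hxy i]
    rw [b.repr_apply_apply] at h2
    rwa [Prod.smul_mk, smul_smul, mul_comm (inner ℂ (b i) x)] at h2

theorem eq_zero_of_mem_diagonalGraph {p : E × E} (hp : p ∈ diagonalGraph b ev) (h0 : p.1 = 0) :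
    p.2 = 0 := by
  refine ext_inner_basis b fun i => ?_
  rw [mem_diagonalGraph.mp hp i, h0]
  simp

theorem isClosable_of_eigenbasis (hsymm : T.IsFormalAdjoint T)
    (hb : ∀ i, (b i, (ev i : ℂ) • b i) ∈ T.graph) : T.IsClosable := by
  refine ⟨(diagonalGraph b ev).toLinearPMap, ?_⟩
  rw [Submodule.toLinearPMap_graph_eq _ fun p hp h0 => eq_zero_of_mem_diagonalGraph hp h0]
  exact topologicalClosure_graph_eq hsymm hb

theorem graph_closure_eq (hsymm : T.IsFormalAdjoint T)
    (hb : ∀ i, (b i, (ev i : ℂ) • b i) ∈ T.graph) : T.closure.graph = diagonalGraph b ev := by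
  rw [← (isClosable_of_eigenbasis hsymm hb).graph_closure_eq_closure_graph]
  exact topologicalClosure_graph_eq hsymm hb

theorem dense_domain_of_basis_mem (h : ∀ i, b i ∈ T.domain) : Dense (T.domain : Set E) := by
  have h1 : Submodule.span ℂ (Set.range b) ≤ T.domain :=
    Submodule.span_le.mpr (by rintro _ ⟨i, rfl⟩; exact h i)
  have h2 : Dense (Submodule.span ℂ (Set.range b) : Set E) :=
    (Submodule.dense_iff_topologicalClosure_eq_top).mpr b.dense_span
  exact h2.mono h1

/-- A symmetric operator with a Hilbert basis of eigenvectors is essentially self-adjoint. -/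
theorem isEssentiallySelfAdjoint_of_eigenbasis [CompleteSpace E] (hsymm : T.IsFormalAdjoint T)
    (hb : ∀ i, (b i, (ev i : ℂ) • b i) ∈ T.graph) : IsEssentiallySelfAdjoint T := by
  have hdom : ∀ i, b i ∈ T.domain := fun i => T.mem_domain_of_mem_graph (hb i)
  have hcl := graph_closure_eq hsymm hb
  have hdense := dense_domain_of_basis_mem (T := T.closure) fun i => T.le_closure.1 (hdom i)
  refine ⟨dense_domain_of_basis_mem hdom, hsymm, isClosable_of_eigenbasis hsymm hb, ?_⟩
  rw [LinearPMap.isSelfAdjoint_def]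
  refine LinearPMap.eq_of_eq_graph ?_
  rw [LinearPMap.adjoint_graph_eq_graph_adjoint hdense, hcl]
  ext ⟨x, y⟩
  rw [Submodule.mem_adjoint_iff]
  constructor
  -- Testing a pair of the adjoint graph on the basis vectors gives its coordinates; the converse is
  -- Parseval's identity with real `ev`.
  · intro h i
    have h1 := h (b i) ((ev i : ℂ) • b i) (basis_mem_diagonalGraph b ev i)
    rw [inner_smul_left, Complex.conj_ofReal] at h1
    exact (sub_eq_zero.mp h1).symm
  · intro h u v huv
    rw [sub_eq_zero, ← b.tsum_inner_mul_inner v x, ← b.tsum_inner_mul_inner u y]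
    refine tsum_congr fun i => ?_
    have h1 := congrArg (starRingEnd ℂ) (mem_diagonalGraph.mp huv i)
    rw [map_mul, Complex.conj_ofReal, inner_conj_symm, inner_conj_symm] at h1
    rw [h1, mem_diagonalGraph.mp h i]
    ring

/-- Pairing `(S - z) R y = y` with `b i` determines the coordinates of `R y`. If `z = ev i`, then
`R` would have to map `(S - z) (b i) = 0` back to `b i`. -/
theorem isResolventAt_iff_diagonal {S : E →ₗ.[ℂ] E} (hS : S.graph = diagonalGraph b ev) {z : ℂ}
    {R : E →L[ℂ] E} : IsResolventAt S z R ↔ (∀ i, (ev i : ℂ) ≠ z) ∧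
      ∀ y i, inner ℂ (b i) (R y) = ((ev i : ℂ) - z)⁻¹ * inner ℂ (b i) y := by
  have hmem (x : S.domain) : ((x : E), S x) ∈ diagonalGraph b ev := hS ▸ S.mem_graph x
  constructor
  · rintro ⟨h1, h2⟩
    have hne : ∀ i, (ev i : ℂ) ≠ z := by
      rintro i rfl
      have hbi : (b i, (ev i : ℂ) • b i) ∈ S.graph :=
        hS ▸ basis_mem_diagonalGraph b ev i
      obtain ⟨u, hu, hu'⟩ := S.mem_graph_iff.mp hbi
      simp only at hu hu'
      have h3 := h2 u
      rw [hu', hu, sub_self, map_zero] at h3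
      have h4 := b.orthonormal.1 i
      rw [← h3] at h4
      simp at h4
    refine ⟨hne, fun y i => ?_⟩
    obtain ⟨h, hy⟩ := h1 y
    have h3 := mem_diagonalGraph.mp (hmem ⟨R y, h⟩) i
    have h4 := congrArg (inner ℂ (b i)) hy
    rw [inner_sub_right, inner_smul_right, h3, ← sub_mul] at h4
    rw [← h4, inv_mul_cancel_left₀ (sub_ne_zero.mpr (hne i))]
  · rintro ⟨hne, hR⟩
    refine ⟨fun y => ?_, fun x => ?_⟩
    · have h : (R y, y + z • R y) ∈ S.graph := by
        rw [hS]
        intro i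
        simp only [inner_add_right, inner_smul_right, hR]
        have := sub_ne_zero.mpr (hne i)
        field_simp
        ring
      obtain ⟨u, hu, hu'⟩ := S.mem_graph_iff.mp h
      simp only at hu hu'
      refine ⟨hu ▸ u.2, ?_⟩
      have h3 : (⟨R y, hu ▸ u.2⟩ : S.domain) = u := Subtype.ext hu.symm
      rw [h3, hu']
      simp
    · refine ext_inner_basis b fun i => ?_
      rw [hR, inner_sub_right, inner_smul_right, mem_diagonalGraph.mp (hmem x) i, ← sub_mul,
        inv_mul_cancel_left₀ (sub_ne_zero.mpr (hne i))]

theorem tendsto_inv_sub_cofinite (hev : Tendsto (fun i => |ev i|) cofinite atTop) (z : ℂ) :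
    Tendsto (fun i => ((ev i : ℂ) - z)⁻¹) cofinite (𝓝 0) := by
  refine tendsto_inv₀_cobounded.comp ?_
  rw [← tendsto_norm_atTop_iff_cobounded]
  refine tendsto_atTop_mono (f := fun i => |ev i| - ‖z‖) (fun i => ?_)
    (tendsto_atTop_add_const_right _ _ hev)
  simpa using norm_sub_norm_le (ev i : ℂ) z

theorem mem_resolventSet_iff {S : E →ₗ.[ℂ] E} (hS : S.graph = diagonalGraph b ev)
    (hev : Tendsto (fun i => |ev i|) cofinite atTop) {z : ℂ} :
    z ∈ resolventSet S ↔ ∀ i, (ev i : ℂ) ≠ z := by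
  refine ⟨fun ⟨R, hR⟩ => ((isResolventAt_iff_diagonal hS).mp hR).1, fun h => ?_⟩
  have hbdd : BddAbove (Set.range fun i => ‖((ev i : ℂ) - z)⁻¹‖) := by
    have h1 := (tendsto_inv_sub_cofinite hev z).norm
    exact h1.bddAbove_range_of_cofinite
  obtain ⟨K, hK⟩ := hbdd
  exact ⟨diagonalOp b (fun i => ((ev i : ℂ) - z)⁻¹) K fun i => hK ⟨i, rfl⟩,
    (isResolventAt_iff_diagonal hS).mpr ⟨h, fun y i => inner_diagonalOp ..⟩⟩

/-- A symmetric operator with a Hilbert basis of eigenvectors whose eigenvalues tend to infinity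
has a closure with compact resolvent, whose spectrum is the set of eigenvalues. -/
theorem compactResolvent_and_spectrum_of_eigenbasis [CompleteSpace E]
    (hsymm : T.IsFormalAdjoint T) (hb : ∀ i, (b i, (ev i : ℂ) • b i) ∈ T.graph)
    (hev : Tendsto (fun i => |ev i|) cofinite atTop) :
    HasCompactResolvent T.closure ∧ spectrum T.closure = Set.range fun i => (ev i : ℂ) := by
  have hS := graph_closure_eq hsymm hb
  -- The eigenvalues are real, so `Complex.I` is in the resolvent set.
  refine ⟨⟨⟨Complex.I, (mem_resolventSet_iff hS hev).mpr fun i h => ?_⟩, fun z R hR => ?_⟩, ?_⟩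
  · simpa using congrArg Complex.im h
  · exact isCompactOperator_of_diagonal b _ (tendsto_inv_sub_cofinite hev z) R
      ((isResolventAt_iff_diagonal hS).mp hR).2
  · ext z
    rw [spectrum, Set.mem_compl_iff, mem_resolventSet_iff hS hev]
    simp

end Eigenbasis

/-! ### Scalar Laguerre polynomials and their differential equation -/

section Laguerre

theorem ascPochhammer_eval_neg_eq_zero {n k : ℕ} (h : n < k) :
    (ascPochhammer ℝ k).eval (-(n : ℝ)) = 0 := by
  induction k, h using Nat.le_induction with
  | base => rw [ascPochhammer_succ_eval]; simp
  | succ k _ ih => rw [ascPochhammer_succ_eval, ih, zero_mul]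

theorem ascPochhammer_succ_eval_left (k : ℕ) (x : ℝ) :
    (ascPochhammer ℝ (k + 1)).eval x = x * (ascPochhammer ℝ k).eval (x + 1) := by
  rw [ascPochhammer_succ_left]
  simp

/-- The formula needs no restriction on `k`, because `(-n)_k = 0` for `k > n`. -/
theorem coeff_laguerre (n : ℕ) (a : ℝ) (k : ℕ) :
    (laguerre n a).coeff k = (ascPochhammer ℝ n).eval (a + 1) / (n.factorial : ℝ) *
      ((ascPochhammer ℝ k).eval (-(n : ℝ)) /
        ((ascPochhammer ℝ k).eval (a + 1) * (k.factorial : ℝ))) := by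
  rw [laguerre, coeff_C_mul, finsetSum_coeff]
  simp only [coeff_C_mul_X_pow]
  rw [Finset.sum_ite_eq]
  split_ifs with h
  · rfl
  · rw [ascPochhammer_eval_neg_eq_zero (by simpa using h)]
    simp

theorem ascPochhammer_eval_ne_zero {a : ℝ} (ha : 0 < a) (k : ℕ) :
    (ascPochhammer ℝ k).eval (a + 1) ≠ 0 :=
  (ascPochhammer_pos k (a + 1) (by linarith)).ne'

theorem derivative_laguerre_succ {a : ℝ} (ha : 0 < a) (n : ℕ) :
    derivative (laguerre (n + 1) a) = derivative (laguerre n a) - laguerre n a := by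
  ext k
  rw [coeff_sub, coeff_derivative, coeff_derivative, coeff_laguerre, coeff_laguerre,
    coeff_laguerre, ascPochhammer_succ_eval_left k (-((n + 1 : ℕ) : ℝ)),
    ascPochhammer_succ_eval k (-(n : ℝ)), ascPochhammer_succ_eval n, ascPochhammer_succ_eval k,
    Nat.factorial_succ, Nat.factorial_succ,
    show (-((n + 1 : ℕ) : ℝ) + 1) = -(n : ℝ) by push_cast; ring]
  have h1 := ascPochhammer_eval_ne_zero ha k
  have h2 : a + 1 + (k : ℝ) ≠ 0 := by positivity
  have h3 : (n.factorial : ℝ) ≠ 0 := by positivity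
  have h4 : (k.factorial : ℝ) ≠ 0 := by positivity
  have h5 : (n : ℝ) + 1 ≠ 0 := by positivity
  have h6 : (k : ℝ) + 1 ≠ 0 := by positivity
  push_cast
  field_simp
  ring

theorem X_mul_derivative_laguerre_succ {a : ℝ} (ha : 0 < a) (n : ℕ) :
    X * derivative (laguerre (n + 1) a) =
      C ((n : ℝ) + 1) * laguerre (n + 1) a - C ((n : ℝ) + 1 + a) * laguerre n a := by
  ext k
  have hX : (X * derivative (laguerre (n + 1) a)).coeff k =
      k * (laguerre (n + 1) a).coeff k := by
    cases k with
    | zero => simp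
    | succ k => rw [coeff_X_mul, coeff_derivative]; push_cast; ring
  -- Both sides are `-(-(n+1))_{k+1}`, with the last or the first factor split off.
  have hR : ((n : ℝ) + 1 - k) * (ascPochhammer ℝ k).eval (-((n + 1 : ℕ) : ℝ)) =
      ((n : ℝ) + 1) * (ascPochhammer ℝ k).eval (-(n : ℝ)) := by
    have h1 := ascPochhammer_succ_eval_left k (-((n + 1 : ℕ) : ℝ))
    rw [ascPochhammer_succ_eval, show (-((n + 1 : ℕ) : ℝ) + 1) = -(n : ℝ) by push_cast; ring] at h1
    push_cast at h1 ⊢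
    linear_combination -h1
  rw [hX, coeff_sub, coeff_C_mul, coeff_C_mul, coeff_laguerre, coeff_laguerre,
    ascPochhammer_succ_eval n, Nat.factorial_succ]
  have h1 := ascPochhammer_eval_ne_zero ha k
  have h3 : (n.factorial : ℝ) ≠ 0 := by positivity
  have h4 : (k.factorial : ℝ) ≠ 0 := by positivity
  have h5 : (n : ℝ) + 1 ≠ 0 := by positivity
  generalize (ascPochhammer ℝ k).eval (-((n + 1 : ℕ) : ℝ)) = R' at hR ⊢
  push_cast
  field_simp
  linear_combination (-(a + 1 + n)) * (ascPochhammer ℝ n).eval (a + 1) * hR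

/-- Differentiate the relation for `x L_{n+1}'` and eliminate `L_n` and `L_n'` by means of the two
relations. -/
theorem laguerre_differential_equation {a : ℝ} (ha : 0 < a) (n : ℕ) :
    X * derivative (derivative (laguerre n a)) + (C (a + 1) - X) * derivative (laguerre n a) +
      C (n : ℝ) * laguerre n a = 0 := by
  cases n with
  | zero => simp [laguerre]
  | succ n =>
    have h1 := derivative_laguerre_succ ha n
    have h2 := X_mul_derivative_laguerre_succ ha n
    have h3 := congrArg derivative h2
    simp only [derivative_mul, derivative_X, derivative_sub, derivative_C, zero_mul, zero_add,
      one_mul] at h3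
    push_cast
    simp only [map_add, map_one] at h2 h3 ⊢
    linear_combination h3 + (C (n : ℝ) + 1 + C a) * h1 - h2

theorem degree_laguerre {a : ℝ} (ha : 0 < a) (n : ℕ) : (laguerre n a).degree = n := by
  refine degree_eq_of_le_of_coeff_ne_zero ?_ ?_
  · rw [degree_le_iff_coeff_zero]
    intro k hk
    rw [coeff_laguerre, ascPochhammer_eval_neg_eq_zero (by exact_mod_cast hk)]
    simp
  · rw [coeff_laguerre]
    have h0 : ∀ k ≤ n, (ascPochhammer ℝ k).eval (-(n : ℝ)) ≠ 0 := by
      intro k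
      induction k with
      | zero => simp
      | succ k ih =>
        intro hk
        rw [ascPochhammer_succ_eval]
        refine mul_ne_zero (ih (by omega)) ?_
        have : (k : ℝ) < n := by exact_mod_cast hk
        linarith
    have h1 := ascPochhammer_eval_ne_zero ha n
    have h2 := h0 n le_rfl
    positivity

/-- The Laguerre polynomial with complex coefficients. -/
def claguerre (n : ℕ) (a : ℝ) : ℂ[X] := (laguerre n a).map (algebraMap ℝ ℂ)

theorem derivative_claguerre_succ {a : ℝ} (ha : 0 < a) (n : ℕ) :
    derivative (claguerre (n + 1) a) = derivative (claguerre n a) - claguerre n a := by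
  have h := congrArg (Polynomial.map (algebraMap ℝ ℂ)) (derivative_laguerre_succ ha n)
  simpa only [claguerre, Polynomial.map_sub, ← derivative_map] using h

theorem X_mul_derivative_claguerre_succ {a : ℝ} (ha : 0 < a) (n : ℕ) :
    X * derivative (claguerre (n + 1) a) =
      C ((n : ℂ) + 1) * claguerre (n + 1) a - C ((n : ℂ) + 1 + a) * claguerre n a := by
  have h := congrArg (Polynomial.map (algebraMap ℝ ℂ)) (X_mul_derivative_laguerre_succ ha n)
  simpa [claguerre, ← derivative_map] using h

theorem claguerre_zero (a : ℝ) : claguerre 0 a = 1 := by simp [claguerre, laguerre]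

theorem degree_claguerre {a : ℝ} (ha : 0 < a) (n : ℕ) : (claguerre n a).degree = n := by
  rw [claguerre, degree_map, degree_laguerre ha]

/-- The scalar operator `q ↦ x q'' + (a + 1 - x) q' + c q`. -/
def laguerreOp (a c : ℝ) : ℂ[X] →ₗ[ℂ] ℂ[X] where
  toFun q := X * derivative (derivative q) + (C ((a : ℂ) + 1) - X) * derivative q + C (c : ℂ) * q
  map_add' q r := by simp only [map_add]; ring
  map_smul' r q := by
    simp only [smul_eq_C_mul, derivative_C_mul, RingHom.id_apply]; ring

theorem laguerreOp_apply (a c : ℝ) (q : ℂ[X]) : laguerreOp a c q =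
    X * derivative (derivative q) + (C ((a : ℂ) + 1) - X) * derivative q + C (c : ℂ) * q := rfl

theorem laguerreOp_claguerre {a : ℝ} (ha : 0 < a) (c : ℝ) (n : ℕ) :
    laguerreOp a c (claguerre n a) = ((c - n : ℝ) : ℂ) • claguerre n a := by
  have h := congrArg (Polynomial.map (algebraMap ℝ ℂ)) (laguerre_differential_equation ha n)
  simp only [Polynomial.map_add, Polynomial.map_mul, Polynomial.map_sub, Polynomial.map_X,
    Polynomial.map_C, ← derivative_map, Polynomial.map_zero] at h
  rw [laguerreOp_apply, smul_eq_C_mul]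
  simp only [Complex.coe_algebraMap, map_add, map_one,
    Complex.ofReal_sub, map_sub, Complex.ofReal_natCast] at h ⊢
  change X * derivative (derivative (claguerre n a)) + _ * derivative (claguerre n a) +
    _ * claguerre n a = 0 at h
  linear_combination h

end Laguerre

/-! ### The intertwining of `T₀` with scalar Laguerre operators -/

namespace Params

variable {N : ℕ} (P : Params N)

theorem idx_pos (i : Fin N) : 0 < idx i := by unfold idx; positivity

theorem LPoly_of_le {i j : Fin N} (h : j ≤ i) :
    P.LPoly i j = C (P.μ i / P.μ j) * claguerre (i - j : ℕ) (P.α + idx j) := by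
  simp [LPoly, h, claguerre]

theorem LPoly_of_lt {i j : Fin N} (h : i < j) : P.LPoly i j = 0 := by
  simp [LPoly, not_le.mpr h]

theorem det_LPoly : P.LPoly.det = 1 := by
  rw [Matrix.det_of_isLowerTriangular]
  · refine Finset.prod_eq_one fun i _ => ?_
    simp [LPoly_of_le, claguerre_zero, div_self (P.μ_ne_zero i)]
  · intro i j hij
    exact P.LPoly_of_lt hij

theorem isUnit_det_A_add_one : IsUnit (P.A + 1).det := by
  rw [Matrix.det_of_isLowerTriangular]
  · refine isUnit_iff_ne_zero.mpr (Finset.prod_ne_zero_iff.mpr fun i _ => ?_)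
    simp [A]
  · intro i j hij
    have h : (i : ℕ) < j := hij
    have h2 : i ≠ j := fun e => by simp [e] at h
    simp [A, h2]
    omega

/-- The product `(A + 1)⁻¹ L`. -/
def invALPoly : Matrix (Fin N) (Fin N) ℂ[X] :=
  Matrix.of fun i j => if j ≤ i then
    -(C (P.μ i / P.μ j) * derivative (claguerre (i - j + 1 : ℕ) (P.α + idx j))) else 0

theorem map_A_mul_of_val_eq_succ (B : Matrix (Fin N) (Fin N) ℂ[X]) {i k : Fin N}
    (h : (k : ℕ) + 1 = i) (j : Fin N) :
    (P.A.map C * B) i j = -(C (P.μ i / P.μ k) * B k j) := by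
  rw [Matrix.mul_apply, Finset.sum_eq_single k]
  · simp [A, h]
  · intro l _ hl
    have : (l : ℕ) + 1 ≠ i := fun e => hl (Fin.ext (by omega))
    simp [A, this]
  · simp

theorem map_A_mul_of_lower (B : Matrix (Fin N) (Fin N) ℂ[X]) {i j : Fin N}
    (hB : ∀ k : Fin N, k < j → B k j = 0) (h : i ≤ j) : (P.A.map C * B) i j = 0 := by
  rw [Matrix.mul_apply]
  refine Finset.sum_eq_zero fun k _ => ?_
  by_cases hk : (k : ℕ) + 1 = i
  · have h' : (i : ℕ) ≤ j := h
    rw [hB k (show (k : ℕ) < j by omega), mul_zero]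
  · simp [A, hk]

theorem α_add_idx_pos (j : Fin N) : 0 < P.α + idx j := add_pos P.α_pos (idx_pos j)

theorem ν_add_idx_pos (j : Fin N) : 0 < P.ν + idx j := add_pos P.ν_pos (idx_pos j)

theorem C_div_mul_C_div (i j k : Fin N) :
    (C (P.μ i / P.μ k) * C (P.μ k / P.μ j) : ℂ[X]) = C (P.μ i / P.μ j) := by
  rw [← C_mul, div_mul_div_cancel₀ (P.μ_ne_zero k)]

/-- Left multiplication by `A + 1` subtracts `μ_i / μ_{i-1}` times the previous row. With `m = i -
j`, the entry becomes `(μ_i / μ_j) (L_m' - L_{m+1}')`, which is `(μ_i / μ_j) L_m`. On the diagonal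
there is no previous term, but `L_0' = 0`. -/
theorem A_add_one_mul_invALPoly : (P.A + 1).map C * P.invALPoly = P.LPoly := by
  have hmap : (P.A + 1).map C = P.A.map C + 1 := by
    rw [Matrix.map_add _ (by simp)]
    simp
  rw [hmap, add_mul, one_mul]
  ext1 i j
  rw [Matrix.add_apply]
  have hl : ∀ k : Fin N, k < j → P.invALPoly k j = 0 := fun k hk => by
    simp [invALPoly, not_le.mpr hk]
  have hL := derivative_claguerre_succ (P.α_add_idx_pos j)
  rcases lt_trichotomy i j with h | h | h
  · rw [P.map_A_mul_of_lower _ hl h.le, hl i h, P.LPoly_of_lt h, add_zero]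
  · subst h
    rw [P.map_A_mul_of_lower _ hl le_rfl, P.LPoly_of_le le_rfl]
    simp [invALPoly, hL, claguerre_zero]
  · have h' : (j : ℕ) < i := h
    let k : Fin N := ⟨i - 1, by omega⟩
    have hk : (k : ℕ) + 1 = i := by simp only [k]; omega
    have hjk : j ≤ k := show (j : ℕ) ≤ i - 1 by omega
    rw [P.map_A_mul_of_val_eq_succ _ hk, P.LPoly_of_le h.le]
    simp only [invALPoly, Matrix.of_apply, hjk, h.le, if_true]
    rw [show (k - j + 1 : ℕ) = i - j by omega, hL, ← P.C_div_mul_C_div i j k]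
    ring

theorem map_inv_mul_LPoly : ((P.A + 1)⁻¹).map C * P.LPoly = P.invALPoly := by
  rw [← A_add_one_mul_invALPoly, ← Matrix.mul_assoc, ← Matrix.map_mul,
    Matrix.nonsing_inv_mul _ P.isUnit_det_A_add_one]
  simp

theorem diagonal_map_mul (d : Fin N → ℂ) (B : Matrix (Fin N) (Fin N) ℂ[X]) (i j : Fin N) :
    ((Matrix.diagonal d).map C * B) i j = C (d i) * B i j := by
  rw [Matrix.diagonal_map (by simp), Matrix.diagonal_mul]

/-- This matches the coefficients of `p'` in the intertwining; the term `2 x L'` comes from the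
product rule in `x (p L)''`. Below the diagonal it reduces to the relation for `x L_{m+1}'` with
parameter `α + j`. -/
theorem first_order_intertwining (i j : Fin N) :
    (((X : ℂ[X]) • P.M₁.map C + P.M₂.map C) * P.LPoly) i j =
      2 * X * derivative (P.LPoly i j) +
        (C (((P.ν + idx j : ℝ) : ℂ) + 1) - X) * P.LPoly i j := by
  have hM₁ : P.M₁.map C * P.LPoly = -P.invALPoly := by
    rw [← map_inv_mul_LPoly, M₁, ← Matrix.neg_mul]
    congr 1
    ext1
    simp
  have hM₂ : P.M₂ = Matrix.diagonal (fun i => (P.ν : ℂ) + idx i + 1) +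
      Matrix.diagonal (fun i => (P.α : ℂ) + idx i) * P.A := by
    simp only [M₂, J, ← Matrix.diagonal_one, ← Matrix.diagonal_smul, Matrix.diagonal_add]
    simp
  have hM₂' : (P.M₂.map C * P.LPoly) i j = C ((P.ν : ℂ) + idx i + 1) * P.LPoly i j +
      C ((P.α : ℂ) + idx i) * (P.A.map C * P.LPoly) i j := by
    rw [hM₂, Matrix.map_add _ (by simp), add_mul, Matrix.map_mul, Matrix.mul_assoc,
      Matrix.add_apply, diagonal_map_mul, diagonal_map_mul]
  rw [add_mul, Matrix.smul_mul, hM₁, Matrix.add_apply, hM₂', Matrix.smul_apply, smul_eq_mul,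
    Matrix.neg_apply]
  have hl : ∀ k : Fin N, k < j → P.LPoly k j = 0 := fun k hk => P.LPoly_of_lt hk
  have hL := derivative_claguerre_succ (P.α_add_idx_pos j)
  rcases lt_trichotomy i j with h | h | h
  · rw [P.map_A_mul_of_lower _ hl h.le, hl i h]
    simp [invALPoly, not_le.mpr h]
  · subst h
    rw [P.map_A_mul_of_lower _ hl le_rfl, P.LPoly_of_le le_rfl]
    simp only [invALPoly, Matrix.of_apply, le_rfl, if_true, Nat.sub_self, hL, claguerre_zero,
      div_self (P.μ_ne_zero i)]
    simp
    ring
  · have h' : (j : ℕ) < i := h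
    let k : Fin N := ⟨i - 1, by omega⟩
    have hk : (k : ℕ) + 1 = i := by simp only [k]; omega
    have hjk : j ≤ k := show (j : ℕ) ≤ i - 1 by omega
    obtain ⟨m, hm⟩ : ∃ m : ℕ, (i : ℕ) - j = m + 1 := ⟨i - j - 1, by omega⟩
    have hi : idx i = idx j + (m + 1) := by
      have : (i : ℕ) = j + (m + 1) := by omega
      unfold idx
      rw [this]
      push_cast
      ring
    have hX := X_mul_derivative_claguerre_succ (P.α_add_idx_pos j) m
    rw [P.map_A_mul_of_val_eq_succ _ hk, P.LPoly_of_le h.le, P.LPoly_of_le hjk,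
      ← mul_assoc (C (P.μ i / P.μ k)),
      P.C_div_mul_C_div, hi, show (k - j : ℕ) = m by omega, hm]
    simp only [invALPoly, Matrix.of_apply, h.le, if_true, hm]
    rw [derivative_C_mul, hL (m + 1)]
    generalize C (P.μ i / P.μ j) = c
    simp only [Complex.ofReal_add, Complex.ofReal_natCast, Complex.ofReal_one, map_add,
      map_one] at hX ⊢
    linear_combination (-c) * hX

/-- This matches the coefficients of `p`. The entries of `L` satisfy the Laguerre equation with
parameter `α + j` instead of `ν + j`; the discrepancy `(ν - α) L'` is what the term `(α - ν) (A +
1)⁻¹` of `C₀` supplies. -/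
theorem zero_order_intertwining (i j : Fin N) :
    (P.C₀.map C * P.LPoly) i j =
      laguerreOp (P.ν + idx j) (P.α - P.ν - idx j) (P.LPoly i j) := by
  have hC : (P.C₀.map C * P.LPoly) i j = C ((P.α : ℂ) - P.ν) * P.invALPoly i j -
      C (idx i : ℂ) * P.LPoly i j := by
    have : P.C₀.map C = C ((P.α : ℂ) - P.ν) • ((P.A + 1)⁻¹).map C - (J N).map C := by
      ext1 k l
      simp [C₀]
    rw [this, sub_mul, Matrix.smul_mul, map_inv_mul_LPoly, Matrix.sub_apply, Matrix.smul_apply,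
      smul_eq_mul, J, diagonal_map_mul]
  rw [hC]
  rcases lt_or_ge i j with h | h
  · rw [P.LPoly_of_lt h, map_zero]
    simp [invALPoly, not_le.mpr h]
  · have h' : (j : ℕ) ≤ i := h
    have hi : idx i = idx j + ((i - j : ℕ) : ℝ) := by
      unfold idx
      rw [Nat.cast_sub h']
      ring
    have hL := derivative_claguerre_succ (P.α_add_idx_pos j) (i - j)
    have hE := laguerreOp_claguerre (P.α_add_idx_pos j) 0 (i - j)
    rw [P.LPoly_of_le h, ← smul_eq_C_mul (P.μ i / P.μ j), map_smul, hi]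
    simp only [invALPoly, Matrix.of_apply, h, if_true, hL]
    rw [laguerreOp_apply] at hE ⊢
    simp only [smul_eq_C_mul] at hE ⊢
    generalize C (P.μ i / P.μ j) = c
    simp only [Complex.ofReal_add, Complex.ofReal_sub, Complex.ofReal_natCast, Complex.ofReal_zero,
      map_add, map_sub, map_one, map_zero] at hE ⊢
    linear_combination (-c) * hE

/-- Multiplication by `L` intertwines `T₀` with a direct sum of scalar Laguerre operators. -/
theorem T₀Poly_vecMul_LPoly (p : Fin N → ℂ[X]) (j : Fin N) :
    (P.T₀Poly p ᵥ* P.LPoly) j =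
      laguerreOp (P.ν + idx j) (P.α - P.ν - idx j) ((p ᵥ* P.LPoly) j) := by
  rw [T₀Poly_apply, Matrix.add_vecMul, Matrix.add_vecMul, Matrix.vecMul_vecMul,
    Matrix.vecMul_vecMul]
  simp only [Pi.add_apply, Matrix.vecMul, dotProduct, first_order_intertwining,
    zero_order_intertwining, map_sum, ← Finset.sum_add_distrib]
  refine Finset.sum_congr rfl fun i _ => ?_
  simp only [laguerreOp_apply, Pi.smul_apply, smul_eq_mul, deriv_apply, derivative_mul,
    derivative_add]
  ring

end Params

/-! ### Determinacy: exponential decay and vanishing moments -/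

section Moments

open Filter Topology
open scoped FourierTransform SchwartzMap ContDiff

/-- An integrable function on the line with vanishing Fourier transform vanishes. -/
theorem ae_eq_zero_of_fourier_eq_zero {g : ℝ → ℂ} (hg : Integrable g) (h : 𝓕 g = 0) :
    ∀ᵐ x, g x = 0 := by
  refine ae_eq_zero_of_integral_contDiff_smul_eq_zero hg.locallyIntegrable fun ψ hψ hψc => ?_
  have h1 : HasCompactSupport fun x => (ψ x : ℂ) := hψc.comp_left (g := ((↑) : ℝ → ℂ)) rfl
  have h2 : ContDiff ℝ ∞ fun x => (ψ x : ℂ) := Complex.ofRealCLM.contDiff.comp hψ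
  -- The test function is the Fourier transform of a Schwartz function `f`, so the transform can be
  -- moved from `f` to `g`.
  let f : 𝓢(ℝ, ℂ) := 𝓕⁻ (h1.toSchwartzMap h2)
  have hf : ∀ x, 𝓕 (f : ℝ → ℂ) x = ψ x := fun x => by
    rw [← SchwartzMap.fourier_coe]
    simp [f]
  have h3 : ∫ ξ, 𝓕 (f : ℝ → ℂ) ξ • g ξ = ∫ x, f x • 𝓕 g x := by
    simpa using! VectorFourier.integral_fourierIntegral_smul_eq_flip (L := innerₗ ℝ)
      Real.continuous_fourierChar continuous_inner f.integrable hg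
  simpa [hf, h] using h3

/-- One half of the exponential absorbs the power. -/
theorem pow_mul_exp_le {ε : ℝ} (hε : 0 < ε) (k : ℕ) {y : ℝ} (hy : 0 ≤ y) :
    y ^ k * Real.exp (ε / 2 * y) ≤ k.factorial / (ε / 2) ^ k * Real.exp (ε * y) := by
  have h1 := Real.pow_div_factorial_le_exp (ε / 2 * y) (by positivity) k
  rw [mul_pow, div_le_iff₀ (by positivity)] at h1
  rw [show ε * y = ε / 2 * y + ε / 2 * y by ring, Real.exp_add, ← mul_assoc]
  refine mul_le_mul_of_nonneg_right ?_ (Real.exp_pos _).le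
  rw [div_mul_eq_mul_div, le_div_iff₀ (by positivity)]
  linarith

variable {μ : Measure ℝ} {g : ℝ → ℂ} {ε : ℝ}

/-- The series of `e^{itx}` is integrated term by term, each term being a moment of `g`. Domination
by `|x|^k e^{|t||x|} |g|` needs `|t| < ε`; the bound `ε / 2` leaves room for the power. Keeping
`x^k` gives the moments of `e^{itx} g`, so the step can be iterated. -/
theorem integral_pow_mul_exp_eq_zero_step (hε : 0 < ε) (hg : AEStronglyMeasurable g μ)
    (hint : Integrable (fun x => Real.exp (ε * |x|) * ‖g x‖) μ)
    (hmom : ∀ k : ℕ, ∫ x, (x : ℂ) ^ k * g x ∂μ = 0) {t : ℝ} (ht : |t| ≤ ε / 2) (k : ℕ) :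
    ∫ x, (x : ℂ) ^ k * (Complex.exp (t * x * Complex.I) * g x) ∂μ = 0 := by
  let F : ℕ → ℝ → ℂ := fun m x =>
    (x : ℂ) ^ k * ((t * x * Complex.I) ^ m / m.factorial * g x)
  let bd : ℕ → ℝ → ℝ := fun m x => |x| ^ k * ((|t| * |x|) ^ m / m.factorial * ‖g x‖)
  have hexp (z : ℝ) : HasSum (fun m : ℕ => z ^ m / m.factorial) (Real.exp z) := by
    rw [Real.exp_eq_exp_ℝ]
    exact NormedSpace.expSeries_div_hasSum_exp z
  have hcexp (z : ℂ) : HasSum (fun m : ℕ => z ^ m / m.factorial) (Complex.exp z) := by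
    rw [Complex.exp_eq_exp_ℂ]
    exact NormedSpace.expSeries_div_hasSum_exp z
  have hbd (x : ℝ) : HasSum (fun m => bd m x) (|x| ^ k * (Real.exp (|t| * |x|) * ‖g x‖)) :=
    ((hexp (|t| * |x|)).mul_right _).mul_left _
  have h := hasSum_integral_of_dominated_convergence (μ := μ) (F := F)
    (f := fun x => (x : ℂ) ^ k * (Complex.exp (t * x * Complex.I) * g x)) bd
    (fun m => by
      refine AEStronglyMeasurable.mul ?_ (AEStronglyMeasurable.mul ?_ hg) <;>
        exact Continuous.aestronglyMeasurable (by fun_prop))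
    (fun m => Eventually.of_forall fun x => by simp [F, bd])
    (Eventually.of_forall fun x => (hbd x).summable) ?_
    (Eventually.of_forall fun x => ((hcexp _).mul_right _).mul_left _)
  · have h0 : ∀ m, ∫ x, F m x ∂μ = 0 := fun m => by
      have : F m = fun x : ℝ =>
          ((t * Complex.I) ^ m / m.factorial) * ((x : ℂ) ^ (k + m) * g x) := by
        funext x
        simp only [F, mul_pow, pow_add]
        ring
      rw [this, integral_const_mul, hmom, mul_zero]
    simp only [h0] at h
    exact h.unique hasSum_zero
  · have he : (fun x => ∑' m, bd m x) = fun x => |x| ^ k * (Real.exp (|t| * |x|) * ‖g x‖) :=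
      funext fun x => (hbd x).tsum_eq
    rw [he]
    refine (hint.const_mul (k.factorial / (ε / 2) ^ k)).mono' ?_ (Eventually.of_forall fun x => ?_)
    · refine AEStronglyMeasurable.mul ?_ (AEStronglyMeasurable.mul ?_ hg.norm) <;>
        exact Continuous.aestronglyMeasurable (by fun_prop)
    · rw [Real.norm_of_nonneg (by positivity), ← mul_assoc, ← mul_assoc]
      refine mul_le_mul_of_nonneg_right ?_ (norm_nonneg _)
      refine le_trans ?_ (pow_mul_exp_le hε k (abs_nonneg x))
      gcongr

/-- Any frequency is reached in steps of length at most `ε / 2`: replacing `g` by `e^{isx} g`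
changes neither `|g|` nor the decay hypothesis. -/
theorem integral_pow_mul_exp_eq_zero (hε : 0 < ε) (hg : AEStronglyMeasurable g μ)
    (hint : Integrable (fun x => Real.exp (ε * |x|) * ‖g x‖) μ)
    (hmom : ∀ k : ℕ, ∫ x, (x : ℂ) ^ k * g x ∂μ = 0) (n : ℕ) :
    ∀ t : ℝ, |t| ≤ n * (ε / 2) → ∀ k : ℕ,
      ∫ x, (x : ℂ) ^ k * (Complex.exp (t * x * Complex.I) * g x) ∂μ = 0 := by
  induction n with
  | zero =>
    intro t ht k
    have : t = 0 := by simpa using ht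
    simpa [this] using hmom k
  | succ n ih =>
    intro t ht k
    have hn : (0 : ℝ) < n + 1 := by positivity
    let s : ℝ := t * (n / (n + 1))
    let r : ℝ := t / (n + 1)
    push_cast at ht
    have hr : |r| ≤ ε / 2 := by
      rw [abs_div, abs_of_pos hn, div_le_iff₀ hn]
      linarith
    have hs : |s| ≤ n * (ε / 2) := by
      have : s = n * r := by simp only [s, r]; ring
      rw [this, abs_mul, Nat.abs_cast]
      gcongr
    have hsr : t = s + r := by simp only [s, r]; field_simp
    have h := integral_pow_mul_exp_eq_zero_step (g := fun x => Complex.exp (s * x * Complex.I) * g x)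
      hε (AEStronglyMeasurable.mul (Continuous.aestronglyMeasurable (by fun_prop)) hg) ?_
      (ih s hs) hr k
    · rw [← h]
      refine integral_congr_ae (Eventually.of_forall fun x => ?_)
      simp only
      rw [← mul_assoc (Complex.exp _) (Complex.exp _), ← Complex.exp_add, hsr]
      congr 3
      push_cast
      ring
    · refine hint.congr (Eventually.of_forall fun x => ?_)
      simp only [norm_mul]
      rw [← Complex.ofReal_mul, Complex.norm_exp_ofReal_mul_I, one_mul]

/-- An exponentially decaying function with vanishing moments vanishes. -/
theorem ae_eq_zero_of_moments_eq_zero {s : Set ℝ} (hs : MeasurableSet s) (hε : 0 < ε)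
    (hg : AEStronglyMeasurable g (volume.restrict s))
    (hint : Integrable (fun x => Real.exp (ε * |x|) * ‖g x‖) (volume.restrict s))
    (hmom : ∀ k : ℕ, ∫ x in s, (x : ℂ) ^ k * g x = 0) :
    ∀ᵐ x ∂volume.restrict s, g x = 0 := by
  have hgi : Integrable g (volume.restrict s) := by
    refine hint.mono hg (Eventually.of_forall fun x => ?_)
    rw [Real.norm_of_nonneg (by positivity)]
    exact le_mul_of_one_le_left (norm_nonneg _) (Real.one_le_exp (by positivity))
  -- Extension by zero to the line; its Fourier transform at `w` is the zeroth moment of `e^{itx} g`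
  -- at `t = -2πw`.
  have h := ae_eq_zero_of_fourier_eq_zero ((integrable_indicator_iff hs).mpr hgi) ?_
  · rw [ae_restrict_iff' hs]
    filter_upwards [h] with x hx hxs
    simpa [hxs] using hx
  · funext w
    obtain ⟨n, hn⟩ := exists_nat_ge (|-2 * Real.pi * w| / (ε / 2))
    rw [div_le_iff₀ (by positivity)] at hn
    have h := integral_pow_mul_exp_eq_zero hε hg hint hmom n _ hn 0
    rw [Real.fourier_real_eq_integral_exp_smul, Pi.zero_apply, ← h,
      ← integral_indicator hs]
    refine integral_congr_ae (Eventually.of_forall fun x => ?_)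
    simp only [Set.indicator]
    split_ifs
    · rw [pow_zero, one_mul, smul_eq_mul]
      congr 3
      push_cast
      ring
    · simp

end Moments

/-! ### Symmetry of `T₀` and the Hilbert basis of its eigenvectors -/

namespace Params

open Filter Topology

variable {N : ℕ} (P : Params N)

/-! ### The scalar weights -/

theorem integrable_eval_mul_t (q : ℂ[X]) (j : Fin N) :
    Integrable (fun x : ℝ => q.eval (x : ℂ) * (P.t x j : ℂ)) vol := by
  have h := (P.memLp_poly_mul q j).integrable_mul (P.memLp_poly_mul 1 j)
  refine h.congr ?_
  filter_upwards [ae_restrict_mem measurableSet_Ioi] with x hx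
  have h1 : ((Real.sqrt (P.t x j) : ℝ) : ℂ) * (Real.sqrt (P.t x j) : ℝ) = (P.t x j : ℝ) := by
    rw [← Complex.ofReal_mul, Real.mul_self_sqrt (P.t_pos hx j).le]
  simp [mul_assoc, h1]

/-- Integration of polynomials against the scalar weight `e^{-x} x^{ν+j} δ_j`. -/
def weightIntegral (j : Fin N) : ℂ[X] →ₗ[ℂ] ℂ where
  toFun q := ∫ x, q.eval (x : ℂ) * (P.t x j : ℂ) ∂vol
  map_add' q r := by
    rw [← integral_add (P.integrable_eval_mul_t q j) (P.integrable_eval_mul_t r j)]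
    simp [add_mul]
  map_smul' c q := by
    simp [mul_assoc, integral_const_mul]

theorem weightIntegral_apply (j : Fin N) (q : ℂ[X]) :
    P.weightIntegral j q = ∫ x, q.eval (x : ℂ) * (P.t x j : ℂ) ∂vol := rfl

theorem weightIntegral_X_pow (j : Fin N) (k : ℕ) :
    P.weightIntegral j (X ^ k) = ((Real.Gamma (k + (P.ν + idx j) + 1) * P.δ j : ℝ) : ℂ) := by
  have hs : 0 < (k : ℝ) + (P.ν + idx j) + 1 := by
    have := P.ν_add_idx_pos j
    positivity
  rw [weightIntegral_apply, Real.Gamma_eq_integral hs, ← integral_mul_const,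
    ← integral_complex_ofReal]
  refine setIntegral_congr_fun measurableSet_Ioi fun x hx => ?_
  have hx0 : (0 : ℝ) < x := hx
  simp only [eval_pow, eval_X, t]
  rw [add_sub_cancel_right, Real.rpow_add hx0 (k : ℝ), Real.rpow_natCast]
  push_cast
  ring

theorem weightIntegral_X_pow_succ (j : Fin N) (k : ℕ) :
    P.weightIntegral j (X ^ (k + 1)) =
      ((k : ℂ) + ((P.ν + idx j : ℝ) : ℂ) + 1) * P.weightIntegral j (X ^ k) := by
  rw [weightIntegral_X_pow, weightIntegral_X_pow,
    show ((k + 1 : ℕ) : ℝ) + (P.ν + idx j) + 1 = (k + (P.ν + idx j) + 1) + 1 by push_cast; ring,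
    Real.Gamma_add_one]
  · push_cast
    ring
  · have := P.ν_add_idx_pos j
    positivity

/-- The derivative of `x^{ν+j+1} e^{-x} f` has vanishing integral. -/
theorem weightIntegral_divergence (j : Fin N) (f : ℂ[X]) :
    P.weightIntegral j
      (X * derivative f + (C (((P.ν + idx j : ℝ) : ℂ) + 1) - X) * f) = 0 := by
  induction f using Polynomial.induction_on' with
  | add f g hf hg =>
    rw [← add_zero (0 : ℂ)]
    nth_rewrite 1 [← hf]
    rw [← hg, ← map_add]
    congr 1
    rw [derivative_add]
    ring
  | monomial k c =>
    have h : X * derivative (monomial k c) +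
        (C (((P.ν + idx j : ℝ) : ℂ) + 1) - X) * monomial k c =
        (c * (k + ((P.ν + idx j : ℝ) : ℂ) + 1)) • X ^ k - c • (X ^ (k + 1) : ℂ[X]) := by
      have hk : X * derivative (monomial k c) = C (c * k) * X ^ k := by
        rw [derivative_monomial, ← C_mul_X_pow_eq_monomial]
        cases k with
        | zero => simp
        | succ k => rw [Nat.add_sub_cancel]; ring
      rw [hk, ← C_mul_X_pow_eq_monomial, smul_eq_C_mul, smul_eq_C_mul]
      simp only [C_mul, C_add, C_1]
      ring
    rw [h, map_sub, map_smul, map_smul, weightIntegral_X_pow_succ, smul_eq_mul, smul_eq_mul]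
    ring

/-- The difference of the two integrands is the divergence expression of `q' r - q r'`; the terms
with `c` cancel. -/
theorem weightIntegral_laguerreOp_symm (j : Fin N) (c : ℝ) (q r : ℂ[X]) :
    P.weightIntegral j (laguerreOp (P.ν + idx j) c q * r) =
      P.weightIntegral j (q * laguerreOp (P.ν + idx j) c r) := by
  rw [← sub_eq_zero, ← map_sub,
    ← P.weightIntegral_divergence j (derivative q * r - q * derivative r)]
  congr 1
  simp only [laguerreOp_apply, derivative_sub, derivative_mul]
  ring

/-- The polynomial with conjugate coefficients. -/
def conjPoly (q : ℂ[X]) : ℂ[X] := q.map (starRingEnd ℂ)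

theorem eval_conjPoly (q : ℂ[X]) (x : ℝ) :
    (conjPoly q).eval (x : ℂ) = starRingEnd ℂ (q.eval (x : ℂ)) := by
  rw [conjPoly, ← Polynomial.eval_map_apply, Complex.conj_ofReal]

theorem laguerreOp_conjPoly (a c : ℝ) (q : ℂ[X]) :
    laguerreOp a c (conjPoly q) = conjPoly (laguerreOp a c q) := by
  simp [laguerreOp_apply, conjPoly, derivative_map]

/-! ### The inner product of polynomials and the symmetry of `T₀` -/

theorem mulS_polyEmb (p : Fin N → ℂ[X]) :
    P.mulS (P.polyEmb p).fn =ᵐ[vol] P.mulS (polyFun p) :=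
  P.mulS_congr (P.mkL2_fn (polyFun p) (polyFun_aesm p) (P.polyFun_integrable p))

/-- With `f` arbitrary, each summand pairs a polynomial with a fixed function, so that moments can
be read off. -/
theorem inner_eq_sum (f : P.L2) (p : Fin N → ℂ[X]) :
    inner ℂ f (P.polyEmb p) = ∑ j, ∫ x, ((p ᵥ* P.LPoly) j).eval (x : ℂ) *
      (starRingEnd ℂ (P.mulS f.fn x j) * (Real.sqrt (P.t x j) : ℂ)) ∂vol := by
  rw [inner_def]
  have h1 : P.form (P.polyEmb p).fn f.fn =ᵐ[vol] fun x => ∑ j,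
      ((p ᵥ* P.LPoly) j).eval (x : ℂ) *
        (starRingEnd ℂ (P.mulS f.fn x j) * (Real.sqrt (P.t x j) : ℂ)) := by
    filter_upwards [P.form_ae (P.polyEmb p).fn f.fn, P.mulS_polyEmb p] with x h2 h3
    rw [h2, h3, PiLp.inner_apply]
    refine Finset.sum_congr rfl fun j _ => ?_
    have h4 : P.mulS (polyFun p) x j = _ := P.polyFun_vecMul_S p x j
    rw [h4, RCLike.inner_apply]
    ring
  rw [integral_congr_ae h1, integral_finsetSum]
  intro j _
  have h5 : MemLp (fun x => starRingEnd ℂ (P.mulS f.fn x j)) 2 vol :=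
    (f.memLp.eval_piLp j).star
  refine (h5.integrable_mul (P.memLp_poly_mul ((p ᵥ* P.LPoly) j) j)).congr
    (Eventually.of_forall fun x => ?_)
  simp only [Pi.mul_apply]
  ring

theorem inner_polyEmb (p q : Fin N → ℂ[X]) : inner ℂ (P.polyEmb p) (P.polyEmb q) =
    ∑ j, P.weightIntegral j (conjPoly ((p ᵥ* P.LPoly) j) * (q ᵥ* P.LPoly) j) := by
  rw [inner_eq_sum]
  refine Finset.sum_congr rfl fun j _ => integral_congr_ae ?_
  filter_upwards [P.mulS_polyEmb p, ae_restrict_mem measurableSet_Ioi] with x h3 hx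
  have h4 : P.mulS (polyFun p) x j = _ := P.polyFun_vecMul_S p x j
  have h1 : ((Real.sqrt (P.t x j) : ℝ) : ℂ) * (Real.sqrt (P.t x j) : ℝ) = (P.t x j : ℝ) := by
    rw [← Complex.ofReal_mul, Real.mul_self_sqrt (P.t_pos hx j).le]
  rw [h3, h4, map_mul, Complex.conj_ofReal, eval_mul, eval_conjPoly, ← h1]
  ring

/-- After multiplication by `L` this is the scalar symmetry in each component; conjugation passes
through because the scalar operators have real coefficients. -/
theorem inner_T₀Poly (p q : Fin N → ℂ[X]) :
    inner ℂ (P.polyEmb (P.T₀Poly p)) (P.polyEmb q) =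
      inner ℂ (P.polyEmb p) (P.polyEmb (P.T₀Poly q)) := by
  rw [inner_polyEmb, inner_polyEmb]
  refine Finset.sum_congr rfl fun j _ => ?_
  rw [T₀Poly_vecMul_LPoly, T₀Poly_vecMul_LPoly, ← laguerreOp_conjPoly,
    weightIntegral_laguerreOp_symm]

theorem mem_graph_T₀ (p : Fin N → ℂ[X]) : (P.polyEmb p, P.polyEmb (P.T₀Poly p)) ∈ P.T₀.graph :=
  P.T₀.mem_graph_iff.mpr ⟨⟨P.polyEmb p, LinearMap.mem_range_self _ p⟩, rfl, P.T₀_apply p⟩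

theorem isFormalAdjoint_T₀ : P.T₀.IsFormalAdjoint P.T₀ := by
  rintro ⟨_, p, rfl⟩ ⟨_, q, rfl⟩
  rw [T₀_apply, T₀_apply]
  exact P.inner_T₀Poly p q

/-! ### The eigenvectors -/

/-- The row polynomial `p` with `p L = (0, …, q, …, 0)`. -/
def rowPoly (j : Fin N) : ℂ[X] →ₗ[ℂ] (Fin N → ℂ[X]) where
  toFun q := Pi.single j q ᵥ* P.LPoly⁻¹
  map_add' q r := by rw [Pi.single_add, Matrix.add_vecMul]
  map_smul' c q := by rw [Pi.single_smul, Matrix.smul_vecMul, RingHom.id_apply]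

theorem isUnit_det_LPoly : IsUnit P.LPoly.det := by simp [det_LPoly]

theorem rowPoly_vecMul_LPoly (j : Fin N) (q : ℂ[X]) :
    P.rowPoly j q ᵥ* P.LPoly = Pi.single j q := by
  change (Pi.single j q ᵥ* P.LPoly⁻¹) ᵥ* P.LPoly = _
  rw [Matrix.vecMul_vecMul, Matrix.nonsing_inv_mul _ P.isUnit_det_LPoly, Matrix.vecMul_one]

theorem vecMul_LPoly_injective : Function.Injective fun p => p ᵥ* P.LPoly := by
  intro p q h
  have := congrArg (fun r => r ᵥ* P.LPoly⁻¹) h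
  simpa [Matrix.vecMul_vecMul, Matrix.mul_nonsing_inv _ P.isUnit_det_LPoly] using this

theorem T₀Poly_rowPoly (j : Fin N) (q : ℂ[X]) : P.T₀Poly (P.rowPoly j q) =
    P.rowPoly j (laguerreOp (P.ν + idx j) (P.α - P.ν - idx j) q) := by
  refine P.vecMul_LPoly_injective (funext fun i => ?_)
  simp only
  rw [T₀Poly_vecMul_LPoly, rowPoly_vecMul_LPoly, rowPoly_vecMul_LPoly]
  by_cases h : i = j
  · subst h
    simp
  · simp [h]

/-- The eigenvalues of `T₀`. -/
def eigenvalue (i : Fin N × ℕ) : ℝ := P.α - P.ν - idx i.1 - i.2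

/-- The polynomial eigenvectors of `T₀`. -/
def eigenpoly (i : Fin N × ℕ) : Fin N → ℂ[X] :=
  P.rowPoly i.1 (claguerre i.2 (P.ν + idx i.1))

theorem T₀Poly_eigenpoly (i : Fin N × ℕ) :
    P.T₀Poly (P.eigenpoly i) = (P.eigenvalue i : ℂ) • P.eigenpoly i := by
  rw [eigenpoly, T₀Poly_rowPoly, laguerreOp_claguerre (P.ν_add_idx_pos i.1), map_smul]
  rfl

theorem eigenpoly_ne_zero (i : Fin N × ℕ) : P.eigenpoly i ≠ 0 := by
  intro h
  have h1 := congrFun (P.rowPoly_vecMul_LPoly i.1 (claguerre i.2 (P.ν + idx i.1))) i.1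
  change (P.eigenpoly i ᵥ* P.LPoly) i.1 = _ at h1
  rw [h, Matrix.zero_vecMul, Pi.single_eq_same, Pi.zero_apply] at h1
  have h2 := degree_claguerre (P.ν_add_idx_pos i.1) i.2
  rw [← h1] at h2
  simp at h2

/-- Within one component the eigenvalues are distinct and symmetry suffices. Across components they
may coincide, but then the rows `p L` have disjoint supports. -/
theorem inner_eigenpoly {i k : Fin N × ℕ} (h : i ≠ k) :
    inner ℂ (P.polyEmb (P.eigenpoly i)) (P.polyEmb (P.eigenpoly k)) = 0 := by
  by_cases hj : i.1 = k.1
  · have h1 := P.inner_T₀Poly (P.eigenpoly i) (P.eigenpoly k)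
    rw [T₀Poly_eigenpoly, T₀Poly_eigenpoly, map_smul, map_smul, inner_smul_left, inner_smul_right,
      Complex.conj_ofReal, ← sub_eq_zero, ← sub_mul] at h1
    refine (mul_eq_zero.mp h1).resolve_left ?_
    rw [sub_eq_zero, Complex.ofReal_inj]
    intro h2
    refine h (Prod.ext hj ?_)
    rw [eigenvalue, eigenvalue, hj] at h2
    exact_mod_cast (sub_right_injective h2)
  · rw [inner_polyEmb]
    refine Finset.sum_eq_zero fun l _ => ?_
    rw [eigenpoly, eigenpoly, rowPoly_vecMul_LPoly, rowPoly_vecMul_LPoly]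
    by_cases hl : l = i.1
    · rw [Pi.single_eq_of_ne (i := k.1) (by rw [hl]; exact hj), mul_zero, map_zero]
    · rw [Pi.single_eq_of_ne (i := i.1) hl, conjPoly, Polynomial.map_zero, zero_mul, map_zero]

/-- The normalized eigenvectors of `T₀`. -/
def eigenvector (i : Fin N × ℕ) : P.L2 :=
  ((‖P.polyEmb (P.eigenpoly i)‖⁻¹ : ℝ) : ℂ) • P.polyEmb (P.eigenpoly i)

theorem norm_polyEmb_eigenpoly_ne_zero (i : Fin N × ℕ) : ‖P.polyEmb (P.eigenpoly i)‖ ≠ 0 := by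
  rw [norm_ne_zero_iff, Ne, map_eq_zero_iff _ P.polyEmb_injective]
  exact P.eigenpoly_ne_zero i

theorem orthonormal_eigenvector : Orthonormal ℂ P.eigenvector := by
  refine ⟨fun i => ?_, fun i k h => ?_⟩
  · rw [eigenvector, norm_smul, Complex.norm_real, norm_inv, norm_norm,
      inv_mul_cancel₀ (P.norm_polyEmb_eigenpoly_ne_zero i)]
  · simp only [eigenvector, inner_smul_left, inner_smul_right, P.inner_eigenpoly h, mul_zero]

theorem eigenvector_mem_graph (i : Fin N × ℕ) :
    (P.eigenvector i, (P.eigenvalue i : ℂ) • P.eigenvector i) ∈ P.T₀.graph := by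
  have h := P.T₀.graph.smul_mem ((‖P.polyEmb (P.eigenpoly i)‖⁻¹ : ℝ) : ℂ)
    (P.mem_graph_T₀ (P.eigenpoly i))
  rwa [T₀Poly_eigenpoly, map_smul, Prod.smul_mk, smul_comm] at h

/-! ### Completeness of the eigenvectors -/

/-- The scalar Laguerre polynomials as a sequence of polynomials of increasing degree. -/
def claguerreSeq (a : ℝ) (ha : 0 < a) : Polynomial.Sequence ℂ where
  elems' n := claguerre n a
  degree_eq' n := degree_claguerre ha n

theorem span_claguerre {a : ℝ} (ha : 0 < a) :
    Submodule.span ℂ (Set.range fun n => claguerre n a) = ⊤ :=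
  (claguerreSeq a ha).span fun i => isUnit_iff_ne_zero.mpr <| leadingCoeff_ne_zero.mpr fun h => by
    have := degree_claguerre ha i
    change claguerre i a = 0 at h
    rw [h] at this
    simp at this

/-- The square is `e^{x/2} · e^{-x} x^{ν+j} δ_j`, which still decays like `e^{-x/2}`. This is where
the rate `1 / 4` comes from. -/
theorem memLp_exp_mul_sqrt_t (j : Fin N) :
    MemLp (fun x : ℝ => (Real.exp (1 / 4 * |x|) : ℂ) * (Real.sqrt (P.t x j) : ℂ)) 2 vol := by
  have hm : Measurable fun x : ℝ =>
      (Real.exp (1 / 4 * |x|) : ℂ) * (Real.sqrt (P.t x j) : ℂ) := by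
    unfold t
    fun_prop
  rw [memLp_two_iff_integrable_sq_norm hm.aestronglyMeasurable]
  have hs : (-1 : ℝ) < P.ν + idx j := by linarith [P.ν_add_idx_pos j]
  have hg := (integrableOn_rpow_mul_exp_neg_mul_rpow hs one_pos
    (by norm_num : (0 : ℝ) < 1 / 2)).integrable.mul_const (P.δ j)
  refine hg.congr ?_
  filter_upwards [ae_restrict_mem measurableSet_Ioi] with x hx
  have hx0 : (0 : ℝ) < x := hx
  rw [norm_mul, Complex.norm_real, Complex.norm_real, mul_pow, Real.norm_eq_abs,
    Real.norm_eq_abs, sq_abs, sq_abs, Real.sq_sqrt (P.t_pos hx0 j).le, abs_of_pos hx0, t,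
    Real.rpow_one, ← Real.exp_nat_mul, ← mul_assoc, ← mul_assoc, ← Real.exp_add,
    mul_comm (x ^ (P.ν + idx j))]
  congr 3
  push_cast
  ring

/-- Testing on `rowPoly j (X ^ k)` isolates the `k`-th moment of the `j`-th component of `conj (u
S)` times `√t_j`. That function decays exponentially, so it vanishes, and `√t_j > 0`. -/
theorem eq_zero_of_inner_rowPoly_eq_zero (u : P.L2)
    (h : ∀ j q, inner ℂ u (P.polyEmb (P.rowPoly j q)) = 0) : u = 0 := by
  have hcomp : ∀ j, ∀ᵐ x ∂vol, P.mulS u.fn x j = 0 := by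
    intro j
    have h5 : MemLp (fun x => starRingEnd ℂ (P.mulS u.fn x j)) 2 vol :=
      (u.memLp.eval_piLp j).star
    have hsq : AEStronglyMeasurable (fun x => (Real.sqrt (P.t x j) : ℂ)) vol := by
      simpa using (P.memLp_poly_mul 1 j).aestronglyMeasurable
    have hz := ae_eq_zero_of_moments_eq_zero
      (g := fun x => starRingEnd ℂ (P.mulS u.fn x j) * (Real.sqrt (P.t x j) : ℂ))
      measurableSet_Ioi (by norm_num : (0 : ℝ) < 1 / 4)
      (h5.aestronglyMeasurable.mul hsq) ?_ ?_
    · filter_upwards [hz, ae_restrict_mem measurableSet_Ioi] with x hx hx0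
      have h6 : (Real.sqrt (P.t x j) : ℂ) ≠ 0 := by
        exact_mod_cast (Real.sqrt_pos.mpr (P.t_pos hx0 j)).ne'
      simpa using (mul_eq_zero.mp hx).resolve_right h6
    · refine (h5.integrable_mul (P.memLp_exp_mul_sqrt_t j)).norm.congr
        (Eventually.of_forall fun x => ?_)
      simp only [Pi.mul_apply, norm_mul, Complex.norm_real, Real.norm_eq_abs, Real.abs_exp]
      ring
    · intro k
      have h7 := h j (X ^ k)
      rw [inner_eq_sum, rowPoly_vecMul_LPoly, Finset.sum_eq_single j] at h7
      · simpa using h7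
      · intro l _ hl
        simp [hl]
      · simp
  refine P.toLp_injective ?_
  rw [map_zero]
  refine Lp.ext ((MemLp.coeFn_toLp u.memLp).trans ?_)
  filter_upwards [ae_all_iff.mpr hcomp, Lp.coeFn_zero (EuclideanSpace ℂ (Fin N)) 2 vol]
    with x hx hx0
  rw [hx0]
  ext j
  exact hx j

theorem orthogonal_span_eigenvector :
    (Submodule.span ℂ (Set.range P.eigenvector))ᗮ = ⊥ := by
  rw [Submodule.eq_bot_iff]
  intro u hu
  refine P.eq_zero_of_inner_rowPoly_eq_zero u fun j q => ?_
  let φ : ℂ[X] →ₗ[ℂ] ℂ := (innerₛₗ ℂ u) ∘ₗ P.polyEmb ∘ₗ P.rowPoly j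
  -- For fixed `j` the polynomials `L_n^{(ν+j)}` span `ℂ[X]`, so orthogonality to the eigenvectors
  -- extends to every `rowPoly j q`.
  have hle : Submodule.span ℂ (Set.range fun n => claguerre n (P.ν + idx j)) ≤ φ.ker := by
    rw [Submodule.span_le]
    rintro _ ⟨n, rfl⟩
    have h1 := (Submodule.mem_orthogonal' _ u).mp hu _
      (Submodule.subset_span ⟨(j, n), rfl⟩)
    rw [eigenvector, inner_smul_right] at h1
    refine (mul_eq_zero.mp h1).resolve_left ?_
    exact_mod_cast inv_ne_zero (P.norm_polyEmb_eigenpoly_ne_zero (j, n))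
  rw [span_claguerre (P.ν_add_idx_pos j)] at hle
  exact hle (Submodule.mem_top : q ∈ ⊤)

/-- The Hilbert basis of eigenvectors of `T₀`. -/
def eigenbasis : HilbertBasis (Fin N × ℕ) ℂ P.L2 :=
  HilbertBasis.mkOfOrthogonalEqBot P.orthonormal_eigenvector P.orthogonal_span_eigenvector

theorem eigenbasis_mem_graph (i : Fin N × ℕ) :
    (P.eigenbasis i, (P.eigenvalue i : ℂ) • P.eigenbasis i) ∈ P.T₀.graph := by
  rw [eigenbasis, HilbertBasis.coe_mkOfOrthogonalEqBot]
  exact P.eigenvector_mem_graph i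

theorem tendsto_abs_eigenvalue : Tendsto (fun i => |P.eigenvalue i|) cofinite atTop := by
  rw [tendsto_atTop]
  intro K
  -- The eigenvalue at `(j, n)` is at most `|α - ν| - n`, so `n ≥ M` makes its absolute value at
  -- least `K`.
  obtain ⟨M, hM⟩ := exists_nat_ge (K + |P.α - P.ν|)
  refine Set.Finite.subset (Set.finite_univ.prod (Set.finite_lt_nat M)) fun i hi => ⟨trivial, ?_⟩
  by_contra hn
  refine hi (show K ≤ |P.eigenvalue i| from ?_)
  have h1 : (M : ℝ) ≤ i.2 := by exact_mod_cast not_lt.mp hn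
  have h2 := neg_abs_le (P.eigenvalue i)
  have h3 := le_abs_self (P.α - P.ν)
  have h4 := idx_pos i.1
  unfold eigenvalue at h2 ⊢
  linarith

theorem range_eigenvalue (hN : 1 ≤ N) : (Set.range fun i => (P.eigenvalue i : ℂ)) =
    {z : ℂ | ∃ n : ℕ, z = (P.α : ℂ) - (P.ν : ℂ) - 1 - (n : ℂ)} := by
  ext z
  constructor
  · rintro ⟨⟨j, n⟩, rfl⟩
    -- Here `j` counts from zero while `idx j = j + 1`, which accounts for the `- 1`. Conversely the
    -- first component alone gives every value; this uses `1 ≤ N`.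
    refine ⟨j + n, ?_⟩
    simp only [eigenvalue, idx]
    push_cast
    ring
  · rintro ⟨n, rfl⟩
    exact ⟨(⟨0, hN⟩, n), by simp [eigenvalue, idx]⟩

end Params

end MatrixLaguerre

end

theorem mainTheorem10 (N : ℕ) (hN : 1 ≤ N) (P : MatrixLaguerre.Params N) :
    MatrixLaguerre.IsEssentiallySelfAdjoint P.T₀ ∧
      MatrixLaguerre.HasCompactResolvent P.T₀.closure ∧
      MatrixLaguerre.spectrum P.T₀.closure =
        {z : ℂ | ∃ n : ℕ, z = (P.α : ℂ) - (P.ν : ℂ) - 1 - (n : ℂ)} := by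
  rw [← P.range_eigenvalue hN]
  exact ⟨MatrixLaguerre.isEssentiallySelfAdjoint_of_eigenbasis P.isFormalAdjoint_T₀
      P.eigenbasis_mem_graph,
    MatrixLaguerre.compactResolvent_and_spectrum_of_eigenbasis P.isFormalAdjoint_T₀
      P.eigenbasis_mem_graph P.tendsto_abs_eigenvalue⟩
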